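/- Let $a$ be either Euler's totient function $\phi$ or the sum-of-divisors function $\sigma$. For a positive integer $k$ let $a_k$ denote the $k$-th iterate of $a$ (so $a_1=a$ and $a_{k+1}=a\circ a_k$), and for a positive integer $n$ let $N_a^k(n)=\#\{m\ge 1: a_k(m)=n\}$. For a positive integer $k$, a real number $\beta$ and $n$ sufficiently large (so that $\log\log\log n>0$), put $$L_{k,\beta}(n)=\exp\left(\frac{\log n\,(\log\log\log n)^{\beta}}{(\log\log n)^{k}}\right).$$ Fix $a\in\{\phi,\sigma\}$, a positive integer $k$ and a real number $\beta<k-1$. Then, as $n\to\infty$ through the positive integers, $$N_a^k(n)\le \frac{n}{L_{k,\beta+1}(n)^{1+o(1)}},$$ that is, there is a function $\varepsilon(n)$ (depending on $a$, $k$ and $\beta$) with $\varepsilon(n)\to 0$ as $n\to\infty$ such that, for all sufficiently large $n$, $N_a^k(n)$ is finite and $N_a^k(n)\le n/L_{k,\beta+1}(n)^{1+\varepsilon(n)}$. -/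

import Mathlib

/-- The set of positive integers `m` whose image under the `k`-th iterate of `a` is `n`. -/
def iteratePreimage (a : ℕ → ℕ) (k n : ℕ) : Set ℕ :=
  {m : ℕ | 0 < m ∧ a^[k] m = n}

/-- The number of positive integers `m` whose image under the `k`-th iterate of `a` is `n`
(meaningful when the set of such `m` is finite). -/
noncomputable def iteratePreimageCount (a : ℕ → ℕ) (k n : ℕ) : ℕ :=
  (iteratePreimage a k n).ncard

/-- `L_{k,β}(n) = exp (log n · (log log log n)^β / (log log n)^k)`. -/
noncomputable def pomeranceL (k : ℕ) (β : ℝ) (n : ℕ) : ℝ :=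
  Real.exp (Real.log n * Real.log (Real.log (Real.log n)) ^ β / Real.log (Real.log n) ^ k)

/-! Rankin's method along a chain of thin sets. Write `y = log n`, `u = log y`, `v = log u`. If a
prime `q` divides `j`, then `q - 1` divides `φ(j)`, and `q + 1` divides `σ(j)` provided `q` divides
`j` exactly once. So, going back from `n`, the primes of each iterate are neighbours of divisors of
the next one, and `m` lies in a set built in `k` steps from the divisors of `n` (`chainSet`). The
sum of `d ^ (-(1 - δ))` over such a set is bounded by an Euler product, in which primes below a
cutoff `Z` cost a Mertens-type sum and larger ones are charged to the previous set
(`sum_rpow_chainSet_succ_le`). When this sum is at most `exp √y`, Rankin's inequality bounds the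
number of `m` by `n * exp (-c * δ * y)`. In `exists_saving` the saving `δ` is chosen to exceed every
multiple of `v ^ (β + 1) / u ^ k`, so the error `ε` may even be taken to be zero.

For `φ` this suffices, since every preimage is at most `n` times a power of `y`. For `σ` the chain
breaks at primes whose square divides an iterate. These are recorded in `squareType`; once it is
fixed, only polylogarithmically many primes are exceptional, and the chain argument tolerates those.
A large square part is rare, because the sum of `1 / m` over the `m` with `w ∣ σ_i(m)` is close to
`1 / w` when `w` avoids the exceptional primes (`sum_inv_squareType_le`). A small one leaves few
choices. The two cases are balanced one iterate at a time in `eventually_card_squareType_fiber_le`.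
-/

/-! ### Sums over primes and Euler products. -/

theorem sum_inv_Icc_le (N : ℕ) : ∑ m ∈ Finset.Icc 1 N, (m : ℝ)⁻¹ ≤ 1 + Real.log N := by
  have := harmonic_le_one_add_log N
  rw [harmonic_eq_sum_Icc] at this
  push_cast at this
  exact this

open Finset in
/-- A Mertens-type bound for the sum of the reciprocals of the primes up to `Z`. -/
theorem sum_inv_primes_le {P : Finset ℕ} {Z : ℝ} (hZ : 1 ≤ Z)
    (hP : ∀ p ∈ P, p.Prime ∧ (p : ℝ) ≤ Z) :
    ∑ p ∈ P, (p : ℝ)⁻¹ ≤ 4 * (1 + Real.log (1 + 2 * Real.log Z)) := by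
  set N := Nat.log 2 ⌊Z⌋₊ with hN
  have hmaps : ∀ p ∈ P, Nat.log 2 p ∈ Finset.Icc 1 N := by
    intro p hp
    obtain ⟨h1, h2⟩ := hP p hp
    rw [Finset.mem_Icc]
    refine ⟨Nat.log_pos one_lt_two h1.two_le, Nat.log_mono_right (Nat.le_floor h2)⟩
  rw [← Finset.sum_fiberwise_of_maps_to hmaps]
  -- Chebyshev's bound on a dyadic block: it holds at most `4 * 2 ^ j / j` primes, each at least `2
  -- ^ j`. Summing `4 / j` gives the double logarithm.
  have hfib : ∀ j ∈ Finset.Icc 1 N, ∑ p ∈ P with Nat.log 2 p = j, (p : ℝ)⁻¹ ≤ 4 * (j : ℝ)⁻¹ := by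
    intro j hj
    have hj1 : 1 ≤ j := (Finset.mem_Icc.mp hj).1
    set A := P.filter (fun p => Nat.log 2 p = j)
    have hA : ∀ p ∈ A, p.Prime ∧ 2 ^ j ≤ p ∧ p < 2 ^ (j + 1) := by
      intro p hp
      obtain ⟨hp1, hp2⟩ := Finset.mem_filter.mp hp
      have hpp := (hP p hp1).1
      refine ⟨hpp, ?_, ?_⟩
      · rw [← hp2]; exact Nat.pow_log_le_self 2 hpp.ne_zero
      · rw [← hp2]; exact Nat.lt_pow_succ_log_self one_lt_two p
    have hl2 : 0 < Real.log 2 := Real.log_pos one_lt_two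
    have hjpos : (0 : ℝ) < j := by exact_mod_cast hj1
    have hcard : (#A : ℝ) * (j * Real.log 2) ≤ (2 * Real.log 2) * 2 ^ (j + 1) := by
      calc (#A : ℝ) * (j * Real.log 2) = ∑ p ∈ A, (j * Real.log 2) := by simp
        _ ≤ ∑ p ∈ A, Real.log p := by
          refine Finset.sum_le_sum fun p hp => ?_
          rw [← Real.log_pow]
          exact Real.log_le_log (by positivity) (by exact_mod_cast (hA p hp).2.1)
        _ ≤ Chebyshev.theta (2 ^ (j + 1)) := by
          unfold Chebyshev.theta
          refine Finset.sum_le_sum_of_subset_of_nonneg ?_ ?_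
          · intro p hp
            obtain ⟨h1, h2, h3⟩ := hA p hp
            rw [Finset.mem_filter, Finset.mem_Ioc]
            refine ⟨⟨h1.pos, Nat.le_floor (by exact_mod_cast h3.le)⟩, h1⟩
          · intro p _ _
            exact Real.log_natCast_nonneg p
        _ ≤ Real.log 4 * 2 ^ (j + 1) := Chebyshev.theta_le_log4_mul_x (by positivity)
        _ = _ := by
          rw [show (4 : ℝ) = 2 ^ 2 by norm_num, Real.log_pow]; push_cast; ring
    have h1 : ∑ p ∈ A, (p : ℝ)⁻¹ ≤ #A * ((2 : ℝ) ^ j)⁻¹ := by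
      rw [← nsmul_eq_mul]
      refine Finset.sum_le_card_nsmul _ _ _ fun p hp => ?_
      exact inv_anti₀ (by positivity) (by exact_mod_cast (hA p hp).2.1)
    refine h1.trans ?_
    have h2 : (#A : ℝ) * j ≤ 2 * 2 ^ (j + 1) := by
      have : ((#A : ℝ) * j) * Real.log 2 ≤ (2 * 2 ^ (j + 1)) * Real.log 2 := by linarith
      exact le_of_mul_le_mul_right this hl2
    rw [← div_eq_mul_inv, ← div_eq_mul_inv, div_le_div_iff₀ (by positivity) hjpos]
    rw [pow_succ] at h2; linarith
  refine (Finset.sum_le_sum hfib).trans ?_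
  rw [← Finset.mul_sum]
  have hh := sum_inv_Icc_le N
  have hlogZ : 0 ≤ Real.log Z := Real.log_nonneg hZ
  have hNle : (N : ℝ) ≤ 2 * Real.log Z := by
    have hf : (2 : ℝ) ^ N ≤ Z := by
      have h1 : 2 ^ N ≤ ⌊Z⌋₊ := Nat.pow_log_le_self 2 (Nat.floor_pos.mpr hZ).ne'
      calc (2 : ℝ) ^ N = ((2 ^ N : ℕ) : ℝ) := by push_cast; rfl
        _ ≤ (⌊Z⌋₊ : ℝ) := by exact_mod_cast h1
        _ ≤ Z := Nat.floor_le (by linarith)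
    have := Real.log_le_log (by positivity) hf
    rw [Real.log_pow] at this
    have hl := Real.log_two_gt_d9
    nlinarith [(Nat.cast_nonneg N : (0 : ℝ) ≤ N)]
  have : Real.log (N : ℝ) ≤ Real.log (1 + 2 * Real.log Z) := by
    rcases Nat.eq_zero_or_pos N with h0 | h0
    · rw [h0]; simp only [Nat.cast_zero, Real.log_zero]
      exact Real.log_nonneg (by linarith)
    · exact Real.log_le_log (by exact_mod_cast h0) (by linarith)
  linarith

theorem sum_rpow_primes_le {P : Finset ℕ} {Z t : ℝ} (hZ : 1 ≤ Z) (ht : t ≤ 1)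
    (hP : ∀ p ∈ P, p.Prime ∧ (p : ℝ) ≤ Z) :
    ∑ p ∈ P, (p : ℝ) ^ (-t) ≤ Z ^ (1 - t) * (4 * (1 + Real.log (1 + 2 * Real.log Z))) := by
  refine le_trans ?_ (mul_le_mul_of_nonneg_left (sum_inv_primes_le hZ hP) (by positivity))
  rw [Finset.mul_sum]
  refine Finset.sum_le_sum fun p hp => ?_
  obtain ⟨h1, h2⟩ := hP p hp
  have hp0 : (0 : ℝ) < p := by exact_mod_cast h1.pos
  calc (p : ℝ) ^ (-t) = (p : ℝ) ^ (1 - t) * (p : ℝ)⁻¹ := by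
        rw [← Real.rpow_neg_one, ← Real.rpow_add hp0]; ring_nf
    _ ≤ _ := by gcongr

/-- Summing `d ^ (-t)` over integers composed of primes from `P`. -/
theorem sum_rpow_le_exp_of_primeFactors_subset {V P : Finset ℕ} {t : ℝ} (ht : 3 / 4 ≤ t)
    (hV : ∀ d ∈ V, d ≠ 0 ∧ ∀ q, q.Prime → q ∣ d → q ∈ P) :
    ∑ d ∈ V, (d : ℝ) ^ (-t) ≤ Real.exp (4 * ∑ p ∈ P with p.Prime, (p : ℝ) ^ (-t)) := by
  let f : ℕ →* ℝ :=
    { toFun := fun d => (d : ℝ) ^ (-t)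
      map_one' := by simp
      map_mul' := fun a b => by
        push_cast; exact Real.mul_rpow (Nat.cast_nonneg a) (Nat.cast_nonneg b) }
  -- The range `x ≤ 3 / 4` is exactly where `(1 - x)⁻¹ ≤ 1 + 4 * x`, which turns each Euler factor
  -- into `exp (4 * x)`.
  have hfx : ∀ p : ℕ, p.Prime → f p ≤ 3 / 4 := by
    intro p hp
    have h2 : (2 : ℝ) ≤ p := by exact_mod_cast hp.two_le
    calc (p : ℝ) ^ (-t) ≤ (2 : ℝ) ^ (-t) :=
          Real.rpow_le_rpow_of_nonpos (by norm_num) h2 (by linarith)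
      _ ≤ (2 : ℝ) ^ (-(3 / 4) : ℝ) :=
          Real.rpow_le_rpow_of_exponent_le (by norm_num) (by linarith)
      _ ≤ 3 / 4 := by
          have h : (2 : ℝ) ^ (-(3 / 4) : ℝ) = ((2 : ℝ) ^ (3 / 4 : ℝ))⁻¹ := by
            rw [Real.rpow_neg (by norm_num)]
          rw [h, inv_le_comm₀ (by positivity) (by norm_num)]
          have h3 : ((3 / 4 : ℝ)⁻¹) ^ (4 : ℕ) ≤ ((2 : ℝ) ^ (3 / 4 : ℝ)) ^ (4 : ℕ) := by
            rw [← Real.rpow_natCast ((2 : ℝ) ^ (3 / 4 : ℝ)), ← Real.rpow_mul (by norm_num)]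
            norm_num
          exact le_of_pow_le_pow_left₀ (by norm_num) (by positivity) h3
  have hf0 : ∀ d, 0 ≤ f d := fun d => Real.rpow_nonneg (Nat.cast_nonneg d) _
  obtain ⟨hs, hS⟩ := EulerProduct.summable_and_hasSum_factoredNumbers_prod_filter_prime_geometric
    (f := f) (fun {p} hp => by
      rw [Real.norm_of_nonneg (hf0 p)]; linarith [hfx p hp]) P
  have hle : ∑ d ∈ V, (d : ℝ) ^ (-t) ≤ ∏ p ∈ P with p.Prime, (1 - f p)⁻¹ := by
    rw [← hS.tsum_eq]
    have hmem : ∀ d ∈ V, d ∈ Nat.factoredNumbers P := fun d hd =>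
      Nat.mem_factoredNumbers'.mpr (hV d hd).2
    have h1 : ∑ d ∈ V, (d : ℝ) ^ (-t) = ∑ d ∈ V.subtype (· ∈ Nat.factoredNumbers P), f d := by
      rw [Finset.sum_subtype_of_mem (f := fun d => f d) hmem]; rfl
    rw [h1]
    exact hS.summable.sum_le_tsum _ (fun d _ => hf0 d)
  refine hle.trans ?_
  rw [Finset.mul_sum, Real.exp_sum]
  refine Finset.prod_le_prod ?_ ?_
  · intro p hp
    have := hfx p (Finset.mem_filter.mp hp).2
    exact inv_nonneg.mpr (by linarith)
  · intro p hp
    have h1 := hfx p (Finset.mem_filter.mp hp).2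
    have h2 := hf0 p
    change (1 - f p)⁻¹ ≤ Real.exp (4 * f p)
    rw [inv_le_comm₀ (by linarith) (Real.exp_pos _), ← Real.exp_neg]
    have h3 := Real.add_one_le_exp (4 * f p)
    rw [Real.exp_neg, inv_le_comm₀ (Real.exp_pos _) (by linarith)]
    refine le_trans ?_ h3
    rw [inv_le_iff_one_le_mul₀ (by linarith)]
    nlinarith

/-! ### Chain sets and the recursive bound for their Rankin sums. -/

/-- Numbers reached from the divisors of `n` by adjoining, `i` times, the integers in `[1, X]` all
of whose prime factors `q` are in `Q` or have a neighbour `q ± 1` in the previous set. -/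
noncomputable def chainSet (Q : Finset ℕ) (X n : ℕ) : ℕ → Finset ℕ
  | 0 => n.divisors
  | i + 1 => by
    classical
    exact (Finset.Icc 1 X).filter fun d =>
      ∀ q, q.Prime → q ∣ d → q ∈ Q ∨ q - 1 ∈ chainSet Q X n i ∨ q + 1 ∈ chainSet Q X n i

theorem mem_chainSet_succ {Q : Finset ℕ} {X n i d : ℕ} :
    d ∈ chainSet Q X n (i + 1) ↔ (1 ≤ d ∧ d ≤ X) ∧
      ∀ q, q.Prime → q ∣ d → q ∈ Q ∨ q - 1 ∈ chainSet Q X n i ∨ q + 1 ∈ chainSet Q X n i := by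
  simp [chainSet]

theorem pos_of_mem_chainSet {Q : Finset ℕ} {X n i d : ℕ} (h : d ∈ chainSet Q X n i) : 0 < d := by
  cases i with
  | zero => exact Nat.pos_of_mem_divisors h
  | succ i => exact (mem_chainSet_succ.mp h).1.1

theorem mem_chainSet_of_dvd {Q : Finset ℕ} {X n i d e : ℕ} (h : e ∈ chainSet Q X n i)
    (hd : d ∣ e) : d ∈ chainSet Q X n i := by
  have he := pos_of_mem_chainSet h
  cases i with
  | zero =>
    rw [chainSet, Nat.mem_divisors] at h ⊢
    exact ⟨hd.trans h.1, h.2⟩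
  | succ i =>
    rw [mem_chainSet_succ] at h ⊢
    refine ⟨⟨Nat.pos_of_dvd_of_pos hd he, (Nat.le_of_dvd he hd).trans h.1.2⟩, ?_⟩
    exact fun q hq hqd => h.2 q hq (hqd.trans hd)

/-- The chain runs backwards: level `i` contains the iterate of order `k - i`, and closure under
divisors puts the neighbours of `q` in the preceding level. -/
theorem iterate_mem_chainSet {a : ℕ → ℕ} {Q : Finset ℕ} {X n k m : ℕ} (hn : 0 < n)
    (hk : a^[k] m = n) (hpos : ∀ i < k, 0 < a^[i] m ∧ a^[i] m ≤ X)
    (hstep : ∀ i < k, ∀ q, q.Prime → q ∣ a^[i] m →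
      q ∈ Q ∨ q - 1 ∣ a^[i + 1] m ∨ q + 1 ∣ a^[i + 1] m) :
    m ∈ chainSet Q X n k := by
  have key : ∀ i ≤ k, a^[k - i] m ∈ chainSet Q X n i := by
    intro i
    induction i with
    | zero =>
      intro _
      rw [chainSet, Nat.sub_zero, hk]
      exact Nat.mem_divisors_self n hn.ne'
    | succ i ih =>
      intro hi
      have hlt : k - (i + 1) < k := by omega
      rw [mem_chainSet_succ]
      refine ⟨hpos _ hlt, fun q hq hqd => ?_⟩
      have hs := hstep _ hlt q hq hqd
      rw [show k - (i + 1) + 1 = k - i by omega] at hs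
      have ih' := ih (by omega)
      exact hs.imp id (Or.imp (mem_chainSet_of_dvd ih') (mem_chainSet_of_dvd ih'))
  simpa using key k le_rfl

open Finset in
-- The admissible primes are split at `Z`. Small ones give the Mertens term, those of `Q` above `Z`
-- give at most `Z ^ (3/4) * Z ^ (-3/4)`, and the neighbours of the previous set gain `Z ^ (-(t -
-- s))` when the exponent is lowered from `t` to `s`. The 3 is 1 for `q - 1` plus 2 for `q + 1`, as
-- `q ^ (-s) ≤ 2 * (q + 1) ^ (-s)`.
theorem sum_rpow_chainSet_succ_le {Q : Finset ℕ} {X n i : ℕ} {s t Z : ℝ} (hZ : 1 ≤ Z)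
    (hQ : (#Q : ℝ) ≤ Z ^ (3 / 4 : ℝ)) (ht : 3 / 4 ≤ t) (ht1 : t ≤ 1) (hs0 : 0 ≤ s) (hst : s ≤ t) :
    ∑ d ∈ chainSet Q X n (i + 1), (d : ℝ) ^ (-t) ≤
      Real.exp (4 * (Z ^ (1 - t) * (4 * (1 + Real.log (1 + 2 * Real.log Z))) + 1 +
        3 * (Z ^ (-(t - s)) * ∑ d ∈ chainSet Q X n i, (d : ℝ) ^ (-s)))) := by
  classical
  set A := chainSet Q X n i with hA
  set P₁ := (Finset.Icc 1 ⌊Z⌋₊).filter Nat.Prime with hP₁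
  set P₂ := Q.filter (fun q : ℕ => Z < (q : ℝ)) with hP₂
  set P₃ := (A.image (· + 1)).filter (fun q : ℕ => q.Prime ∧ Z < (q : ℝ)) with hP₃
  set P₄ := (A.image (· - 1)).filter (fun q : ℕ => q.Prime ∧ Z < (q : ℝ)) with hP₄
  have hV : ∀ d ∈ chainSet Q X n (i + 1), d ≠ 0 ∧ ∀ q, q.Prime → q ∣ d →
      q ∈ P₁ ∪ P₂ ∪ P₃ ∪ P₄ := by
    intro d hd
    refine ⟨(pos_of_mem_chainSet hd).ne', fun q hq hqd => ?_⟩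
    have h := (mem_chainSet_succ.mp hd).2 q hq hqd
    simp only [Finset.mem_union]
    by_cases hqZ : (q : ℝ) ≤ Z
    · left; left; left
      rw [hP₁, Finset.mem_filter, Finset.mem_Icc]
      exact ⟨⟨hq.one_lt.le, Nat.le_floor hqZ⟩, hq⟩
    · push Not at hqZ
      rcases h with h | h | h
      · left; left; right
        exact Finset.mem_filter.mpr ⟨h, hqZ⟩
      · left; right
        refine Finset.mem_filter.mpr ⟨Finset.mem_image.mpr ⟨q - 1, h, ?_⟩, hq, hqZ⟩
        have := hq.pos; omega
      · right
        exact Finset.mem_filter.mpr ⟨Finset.mem_image.mpr ⟨q + 1, h, by simp⟩, hq, hqZ⟩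
  refine (sum_rpow_le_exp_of_primeFactors_subset ht hV).trans ?_
  rw [Real.exp_le_exp]
  refine mul_le_mul_of_nonneg_left ?_ (by norm_num)
  have hnn : ∀ q : ℕ, 0 ≤ (q : ℝ) ^ (-t) := fun q => Real.rpow_nonneg (Nat.cast_nonneg q) _
  have hZ0 : 0 < Z := by linarith
  have hun : ∀ B C : Finset ℕ, ∑ q ∈ B ∪ C, (q : ℝ) ^ (-t) ≤
      ∑ q ∈ B, (q : ℝ) ^ (-t) + ∑ q ∈ C, (q : ℝ) ^ (-t) := fun B C => by
    rw [← Finset.sum_union_inter]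
    exact le_add_of_nonneg_right (Finset.sum_nonneg fun q _ => hnn q)
  have e0 : ∑ p ∈ P₁ ∪ P₂ ∪ P₃ ∪ P₄ with p.Prime, (p : ℝ) ^ (-t) ≤
      ∑ p ∈ P₁ ∪ P₂ ∪ P₃ ∪ P₄, (p : ℝ) ^ (-t) :=
    Finset.sum_le_sum_of_subset_of_nonneg (Finset.filter_subset _ _) fun q _ _ => hnn q
  have e1 : ∑ p ∈ P₁, (p : ℝ) ^ (-t) ≤
      Z ^ (1 - t) * (4 * (1 + Real.log (1 + 2 * Real.log Z))) := by
    refine sum_rpow_primes_le hZ ht1 fun p hp => ?_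
    obtain ⟨h1, h2⟩ := Finset.mem_filter.mp hp
    exact ⟨h2, (Nat.le_floor_iff hZ0.le).mp (Finset.mem_Icc.mp h1).2⟩
  have e2 : ∑ p ∈ P₂, (p : ℝ) ^ (-t) ≤ 1 := by
    calc ∑ p ∈ P₂, (p : ℝ) ^ (-t) ≤ #P₂ • Z ^ (-(3 / 4) : ℝ) := by
          refine Finset.sum_le_card_nsmul _ _ _ fun p hp => ?_
          have hp' := (Finset.mem_filter.mp hp).2
          calc (p : ℝ) ^ (-t) ≤ Z ^ (-t) := Real.rpow_le_rpow_of_nonpos hZ0 hp'.le (by linarith)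
            _ ≤ _ := Real.rpow_le_rpow_of_exponent_le hZ (by linarith)
      _ ≤ Z ^ (3 / 4 : ℝ) * Z ^ (-(3 / 4) : ℝ) := by
          rw [nsmul_eq_mul]
          refine mul_le_mul_of_nonneg_right (le_trans ?_ hQ) (by positivity)
          exact_mod_cast Finset.card_le_card (Finset.filter_subset _ _)
      _ = 1 := by rw [← Real.rpow_add hZ0]; norm_num
  have hshift : ∀ q : ℕ, q.Prime → Z < q → (q : ℝ) ^ (-t) ≤ Z ^ (-(t - s)) * (q : ℝ) ^ (-s) := by
    intro q hq hqZ
    have hq0 : (0 : ℝ) < q := by exact_mod_cast hq.pos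
    calc (q : ℝ) ^ (-t) = (q : ℝ) ^ (-(t - s)) * (q : ℝ) ^ (-s) := by
          rw [← Real.rpow_add hq0]; ring_nf
      _ ≤ _ := by
          refine mul_le_mul_of_nonneg_right ?_ (by positivity)
          exact Real.rpow_le_rpow_of_nonpos hZ0 hqZ.le (by linarith)
  have e3 : ∑ p ∈ P₃, (p : ℝ) ^ (-t) ≤ Z ^ (-(t - s)) * ∑ d ∈ A, (d : ℝ) ^ (-s) := by
    calc ∑ p ∈ P₃, (p : ℝ) ^ (-t) ≤ ∑ p ∈ P₃, Z ^ (-(t - s)) * ((p - 1 : ℕ) : ℝ) ^ (-s) := by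
          refine Finset.sum_le_sum fun q hq => ?_
          obtain ⟨-, hq1, hq2⟩ := Finset.mem_filter.mp hq
          refine (hshift q hq1 hq2).trans (mul_le_mul_of_nonneg_left ?_ (by positivity))
          refine Real.rpow_le_rpow_of_nonpos ?_ ?_ (by linarith)
          · have := hq1.two_le
            exact_mod_cast (by omega : 0 < q - 1)
          · exact_mod_cast Nat.sub_le q 1
      _ = Z ^ (-(t - s)) * ∑ d ∈ P₃.image (fun q : ℕ => q - 1), (d : ℝ) ^ (-s) := by
          rw [← Finset.mul_sum, Finset.sum_image]
          intro x hx y hy hxy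
          have h1 := (Finset.mem_filter.mp hx).2.1.pos
          have h2 := (Finset.mem_filter.mp hy).2.1.pos
          simp only at hxy
          omega
      _ ≤ _ := by
          refine mul_le_mul_of_nonneg_left ?_ (by positivity)
          refine Finset.sum_le_sum_of_subset_of_nonneg ?_ fun d _ _ => by positivity
          intro d hd
          obtain ⟨q, hq, rfl⟩ := Finset.mem_image.mp hd
          obtain ⟨e, he, rfl⟩ := Finset.mem_image.mp (Finset.mem_filter.mp hq).1
          simpa using he
  have e4 : ∑ p ∈ P₄, (p : ℝ) ^ (-t) ≤ Z ^ (-(t - s)) * (2 * ∑ d ∈ A, (d : ℝ) ^ (-s)) := by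
    calc ∑ p ∈ P₄, (p : ℝ) ^ (-t) ≤ ∑ p ∈ P₄, Z ^ (-(t - s)) * (2 * ((p + 1 : ℕ) : ℝ) ^ (-s)) := by
          refine Finset.sum_le_sum fun q hq => ?_
          obtain ⟨-, hq1, hq2⟩ := Finset.mem_filter.mp hq
          refine (hshift q hq1 hq2).trans (mul_le_mul_of_nonneg_left ?_ (by positivity))
          have hq0 : (1 : ℝ) ≤ q := by exact_mod_cast hq1.pos
          have h2 : ((q + 1 : ℕ) : ℝ) ≤ 2 * q := by push_cast; linarith
          calc (q : ℝ) ^ (-s) = 2 ^ s * (2 * (q : ℝ)) ^ (-s) := by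
                rw [Real.mul_rpow (by norm_num) (by linarith), ← mul_assoc,
                  ← Real.rpow_add (by norm_num)]
                simp
            _ ≤ 2 ^ (1 : ℝ) * ((q + 1 : ℕ) : ℝ) ^ (-s) := by
                refine mul_le_mul ?_ ?_ (by positivity) (by positivity)
                · exact Real.rpow_le_rpow_of_exponent_le (by norm_num) (by linarith)
                · exact Real.rpow_le_rpow_of_nonpos (by positivity) h2 (by linarith)
            _ = _ := by norm_num
      _ = Z ^ (-(t - s)) * (2 * ∑ d ∈ P₄.image (fun q : ℕ => q + 1), (d : ℝ) ^ (-s)) := by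
          rw [← Finset.mul_sum, ← Finset.mul_sum, Finset.sum_image]
          intro x _ y _ hxy
          simpa using hxy
      _ ≤ _ := by
          refine mul_le_mul_of_nonneg_left ?_ (by positivity)
          refine mul_le_mul_of_nonneg_left ?_ (by norm_num)
          refine Finset.sum_le_sum_of_subset_of_nonneg ?_ fun d _ _ => by positivity
          intro d hd
          obtain ⟨q, hq, rfl⟩ := Finset.mem_image.mp hd
          obtain ⟨e, he, rfl⟩ := Finset.mem_image.mp (Finset.mem_filter.mp hq).1
          have := pos_of_mem_chainSet he
          simpa [Nat.sub_add_cancel this] using he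
  have u1 := hun (P₁ ∪ P₂ ∪ P₃) P₄
  have u2 := hun (P₁ ∪ P₂) P₃
  have u3 := hun P₁ P₂
  linarith

/-! ### The starting level: divisors of `n`. -/

theorem two_pow_card_primeFactors_le {n : ℕ} (hn : n ≠ 0) : 2 ^ n.primeFactors.card ≤ n := by
  calc 2 ^ n.primeFactors.card ≤ ∏ p ∈ n.primeFactors, p :=
        Finset.pow_card_le_prod _ _ _ fun p hp => (Nat.prime_of_mem_primeFactors hp).two_le
    _ ≤ n := Nat.le_of_dvd (Nat.pos_of_ne_zero hn) (Nat.prod_primeFactors_dvd n)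

theorem card_primeFactors_le_log {n : ℕ} (hn : n ≠ 0) :
    (n.primeFactors.card : ℝ) ≤ 2 * Real.log n := by
  have h : ((2 : ℝ) ^ n.primeFactors.card) ≤ n := by
    exact_mod_cast two_pow_card_primeFactors_le hn
  have h1 := Real.log_le_log (by positivity) h
  rw [Real.log_pow] at h1
  have hl := Real.log_two_gt_d9
  nlinarith [(Nat.cast_nonneg n.primeFactors.card : (0 : ℝ) ≤ n.primeFactors.card)]

open Finset in
-- The primes of `n` are split at `log n`: the smaller ones are bounded by all primes up to `log n`,
-- and the larger ones number at most `2 * log n`.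
theorem sum_rpow_divisors_le {n : ℕ} {s : ℝ} (hn : 1 ≤ Real.log n) (hs : 3 / 4 ≤ s) (hs1 : s ≤ 1) :
    ∑ d ∈ n.divisors, (d : ℝ) ^ (-s) ≤
      Real.exp (4 * (Real.log n ^ (1 - s) *
        (4 * (1 + Real.log (1 + 2 * Real.log (Real.log n))) + 2))) := by
  have hn0 : n ≠ 0 := by rintro rfl; norm_num at hn
  set y := Real.log n
  have hy0 : 0 < y := by linarith
  have hV : ∀ d ∈ n.divisors, d ≠ 0 ∧ ∀ q, q.Prime → q ∣ d → q ∈ n.primeFactors := by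
    intro d hd
    refine ⟨(Nat.pos_of_mem_divisors hd).ne', fun q hq hqd => ?_⟩
    exact Nat.mem_primeFactors.mpr ⟨hq, hqd.trans (Nat.dvd_of_mem_divisors hd), hn0⟩
  refine (sum_rpow_le_exp_of_primeFactors_subset hs hV).trans ?_
  rw [Real.exp_le_exp]
  refine mul_le_mul_of_nonneg_left ?_ (by norm_num)
  have hfil : n.primeFactors.filter Nat.Prime = n.primeFactors :=
    Finset.filter_true_of_mem fun p hp => Nat.prime_of_mem_primeFactors hp
  rw [hfil, ← Finset.sum_filter_add_sum_filter_not n.primeFactors (fun p : ℕ => (p : ℝ) ≤ y), mul_add]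
  refine add_le_add ?_ ?_
  · refine sum_rpow_primes_le hn hs1 fun p hp => ?_
    obtain ⟨h1, h2⟩ := Finset.mem_filter.mp hp
    exact ⟨Nat.prime_of_mem_primeFactors h1, h2⟩
  · calc ∑ p ∈ n.primeFactors.filter (fun p : ℕ => ¬ (p : ℝ) ≤ y), (p : ℝ) ^ (-s)
        ≤ #(n.primeFactors.filter fun p : ℕ => ¬ (p : ℝ) ≤ y) • y ^ (-s) := by
          refine Finset.sum_le_card_nsmul _ _ _ fun p hp => ?_
          have hp' := (Finset.mem_filter.mp hp).2
          push Not at hp'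
          exact Real.rpow_le_rpow_of_nonpos hy0 hp'.le (by linarith)
      _ ≤ (2 * y) * y ^ (-s) := by
          rw [nsmul_eq_mul]
          refine mul_le_mul_of_nonneg_right (le_trans ?_ (card_primeFactors_le_log hn0))
            (by positivity)
          exact_mod_cast Finset.card_le_card (Finset.filter_subset _ _)
      _ = y ^ (1 - s) * 2 := by
          rw [sub_eq_add_neg, Real.rpow_add hy0, Real.rpow_one]; ring

/-! ### Asymptotics of the Rankin sums. -/

open Filter Topology

theorem tendsto_log_natCast : Tendsto (fun n : ℕ => Real.log n) atTop atTop :=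
  Real.tendsto_log_atTop.comp tendsto_natCast_atTop_atTop

theorem tendsto_log_log_natCast :
    Tendsto (fun n : ℕ => Real.log (Real.log n)) atTop atTop :=
  Real.tendsto_log_atTop.comp tendsto_log_natCast

theorem eventually_const_le_rpow {e : ℝ} (he : 0 < e) (K : ℝ) : ∀ᶠ u : ℝ in atTop, K ≤ u ^ e :=
  (tendsto_rpow_atTop he).eventually_ge_atTop K

theorem eventually_mul_log_add_le_rpow {e : ℝ} (he : 0 < e) (C D : ℝ) :
    ∀ᶠ u : ℝ in atTop, C * Real.log u + D ≤ u ^ e := by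
  have h1 := ((isLittleO_log_rpow_atTop he).const_mul_left (2 * C)).bound one_pos
  filter_upwards [h1, eventually_const_le_rpow he (2 * D), eventually_gt_atTop 0] with u h1 h2 h3
  rw [Real.norm_eq_abs, Real.norm_of_nonneg (Real.rpow_nonneg h3.le _)] at h1
  have := le_abs_self (2 * C * Real.log u)
  linarith

theorem one_le_log_of_three_le {u : ℝ} (hu : 3 ≤ u) : 1 ≤ Real.log u := by
  rw [Real.le_log_iff_exp_le (by linarith)]
  linarith [Real.exp_one_lt_d9]

theorem log_one_add_two_mul_le {x : ℝ} (hx : 3 ≤ x) :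
    Real.log (1 + 2 * x) ≤ 2 * Real.log x := by
  have : Real.log (x ^ 2) = 2 * Real.log x := by rw [Real.log_pow]; norm_num
  rw [← this]
  exact Real.log_le_log (by linarith) (by nlinarith)

/-- For `b > 1` the factor `y ^ (u ^ (-b))` is at most `e`, so only the triple logarithm survives in
the exponent; `168 = 4 * 3 * 14`. -/
theorem eventually_sum_divisors_le {b : ℝ} (hb : 1 < b) :
    ∀ᶠ n : ℕ in atTop, ∑ d ∈ n.divisors,
      (d : ℝ) ^ (-(1 - Real.log (Real.log n) ^ (-b))) ≤ Real.log (Real.log n) ^ (168 : ℝ) := by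
  have hu := tendsto_log_log_natCast
  filter_upwards [hu.eventually (eventually_ge_atTop 3),
    hu.eventually (eventually_const_le_rpow (by linarith : 0 < b) 4),
    tendsto_log_natCast.eventually (eventually_ge_atTop 1)] with n h1 h2 h3
  set y := Real.log n
  set u := Real.log y
  have hu0 : 0 < u := by linarith
  have hy0 : 0 < y := by linarith
  have hub : u ^ (-b) ≤ 1 / 4 := by
    rw [Real.rpow_neg hu0.le, inv_le_comm₀ (by linarith) (by norm_num)]
    linarith
  have hub0 : 0 ≤ u ^ (-b) := by positivity
  refine (sum_rpow_divisors_le h3 (by linarith) (by linarith)).trans ?_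
  rw [Real.rpow_def_of_pos hu0 168, Real.exp_le_exp, sub_sub_cancel]
  have hlog := one_le_log_of_three_le h1
  have hy : y ^ (u ^ (-b)) ≤ 3 := by
    rw [Real.rpow_def_of_pos hy0]
    have h : u * u ^ (-b) ≤ 1 := by
      nth_rewrite 1 [← Real.rpow_one u]
      rw [← Real.rpow_add hu0]
      exact Real.rpow_le_one_of_one_le_of_nonpos (by linarith) (by linarith)
    calc Real.exp (u * u ^ (-b)) ≤ Real.exp 1 := Real.exp_le_exp.mpr h
      _ ≤ 3 := by linarith [Real.exp_one_lt_d9]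
  have h5 := log_one_add_two_mul_le h1
  have h6 : 0 ≤ Real.log (1 + 2 * u) := Real.log_nonneg (by linarith)
  have h7 : y ^ (u ^ (-b)) * (4 * (1 + Real.log (1 + 2 * u)) + 2) ≤ 3 * (14 * Real.log u) := by
    refine mul_le_mul hy (by linarith) (by linarith) (by norm_num)
  linarith

/-- Every `b > 1` works at every level: the previous level is used with the larger saving `u ^
(-b')`, where `1 < b' < b`, and the cutoff is `Z = exp (u ^ b)`. Then `Z ^ (u ^ (-b)) = e`, while
the shift gains about `exp (-u ^ (b - b'))`, which absorbs the power of `u` from the previous level.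
-/
theorem eventually_sum_chainSet_le (i : ℕ) (B : ℝ) : ∀ b : ℝ, 1 < b →
    ∃ C : ℝ, ∀ᶠ n : ℕ in atTop, ∀ (Q : Finset ℕ) (X : ℕ), (Q.card : ℝ) ≤ Real.log n ^ B →
      ∑ d ∈ chainSet Q X n i, (d : ℝ) ^ (-(1 - Real.log (Real.log n) ^ (-b))) ≤
        Real.log (Real.log n) ^ C := by
  induction i with
  | zero =>
    intro b hb
    refine ⟨168, ?_⟩
    filter_upwards [eventually_sum_divisors_le hb] with n hn Q X _
    simpa [chainSet] using hn
  | succ i ih =>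
    intro b hb
    obtain ⟨C, hC⟩ := ih ((1 + b) / 2) (by linarith)
    set b' := (1 + b) / 2 with hb'
    have hu := tendsto_log_log_natCast
    -- The Mertens term is at most `3 * 4 * (1 + 2 * b) * log u`; the remaining 4 is 1 from `Q` plus
    -- 3 from the shifted primes.
    refine ⟨4 * (12 * (1 + 2 * b) + 4), ?_⟩
    filter_upwards [hC, hu.eventually (eventually_ge_atTop 3),
      hu.eventually (eventually_const_le_rpow (by linarith : 0 < b) 4),
      hu.eventually (eventually_const_le_rpow (by linarith : 0 < b') 4),
      hu.eventually (eventually_const_le_rpow (by linarith : 0 < b - 1) (4 * B / 3)),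
      hu.eventually (eventually_mul_log_add_le_rpow (by linarith : 0 < b - b') C 1),
      tendsto_log_natCast.eventually (eventually_ge_atTop 1)] with n hn h1 h2 h2' h3 h4 h5 Q X hQ
    have hF := hn Q X hQ
    set y := Real.log n
    set u := Real.log y
    have hu0 : 0 < u := by linarith
    have hy0 : 0 < y := by linarith
    have hub : u ^ (-b) ≤ 1 / 4 := by
      rw [Real.rpow_neg hu0.le, inv_le_comm₀ (by linarith) (by norm_num)]
      linarith
    have hub' : u ^ (-b') ≤ 1 / 4 := by
      rw [Real.rpow_neg hu0.le, inv_le_comm₀ (by linarith) (by norm_num)]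
      linarith
    have hub0 : 0 ≤ u ^ (-b) := by positivity
    have hbb : u ^ (-b) ≤ u ^ (-b') :=
      Real.rpow_le_rpow_of_exponent_le (by linarith) (by linarith)
    have hQZ : (Q.card : ℝ) ≤ Real.exp (u ^ b) ^ (3 / 4 : ℝ) := by
      refine hQ.trans ?_
      rw [Real.rpow_def_of_pos hy0, ← Real.exp_mul, Real.exp_le_exp]
      have : u ^ b = u * u ^ (b - 1) := by
        nth_rewrite 2 [← Real.rpow_one u]
        rw [← Real.rpow_add hu0]; ring_nf
      rw [this]
      nlinarith
    refine (sum_rpow_chainSet_succ_le (s := 1 - u ^ (-b')) (Real.one_le_exp (by positivity)) hQZ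
      (by linarith) (by linarith) (by linarith) (by linarith)).trans ?_
    rw [Real.rpow_def_of_pos hu0 (4 * _), Real.exp_le_exp, Real.log_exp, ← Real.exp_mul, ← Real.exp_mul,
      sub_sub_cancel, ← Real.rpow_add hu0, add_neg_cancel, Real.rpow_zero]
    have hlog := one_le_log_of_three_le h1
    have e1 : Real.log (1 + 2 * u ^ b) ≤ 2 * (b * Real.log u) := by
      rw [← Real.log_rpow hu0]
      exact log_one_add_two_mul_le (by linarith)
    have e1' : 0 ≤ Real.log (1 + 2 * u ^ b) := Real.log_nonneg (by linarith)
    have e2 : Real.exp 1 * (4 * (1 + Real.log (1 + 2 * u ^ b))) ≤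
        3 * (4 * ((1 + 2 * b) * Real.log u)) := by
      refine mul_le_mul (by linarith [Real.exp_one_lt_d9]) ?_ (by linarith) (by norm_num)
      nlinarith
    have e3 : Real.exp (u ^ b * -(1 - u ^ (-b) - (1 - u ^ (-b')))) *
        ∑ d ∈ chainSet Q X n i, (d : ℝ) ^ (-(1 - u ^ (-b'))) ≤ 1 := by
      calc _ ≤ Real.exp (u ^ b * -(1 - u ^ (-b) - (1 - u ^ (-b')))) * u ^ C :=
            mul_le_mul_of_nonneg_left hF (Real.exp_pos _).le
        _ = Real.exp (-u ^ (b - b') + 1 + Real.log u * C) := by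
            rw [Real.rpow_def_of_pos hu0 C, ← Real.exp_add]
            congr 2
            have a1 : u ^ b * u ^ (-b) = 1 := by rw [← Real.rpow_add hu0]; simp
            have a2 : u ^ b * u ^ (-b') = u ^ (b - b') := by
              rw [← Real.rpow_add hu0]; ring_nf
            linear_combination a1 - a2
        _ ≤ 1 := by
            rw [Real.exp_le_one_iff]
            linarith
    linarith

/-! ### Choice of the saving. -/

/-- A saving `δ` that dominates every multiple of `(log log log n) ^ γ / (log log n) ^ k` and for
which the sum of `d ^ (-(1 - δ))` over the `k`-th chain set is small. -/
theorem exists_saving {k : ℕ} (hk : 0 < k) {γ : ℝ} (hγ : γ < k) :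
    ∃ δ : ℕ → ℝ, (∀ᶠ n in atTop, δ n ≤ 1 / 4) ∧
      (∀ᶠ n : ℕ in atTop, Real.log n ^ (3 / 4 : ℝ) ≤ δ n * Real.log n) ∧
      (∀ K : ℝ, ∀ᶠ n : ℕ in atTop,
        K * (Real.log (Real.log (Real.log n)) ^ γ / Real.log (Real.log n) ^ k) ≤ δ n) ∧
      ∀ B : ℝ, ∀ᶠ n : ℕ in atTop, ∀ (Q : Finset ℕ) (X : ℕ), (Q.card : ℝ) ≤ Real.log n ^ B →
        ∑ d ∈ chainSet Q X n k, (d : ℝ) ^ (-(1 - δ n)) ≤ Real.exp (√(Real.log n)) := by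
  have hu := tendsto_log_log_natCast
  have hy := tendsto_log_natCast
  rcases Nat.lt_or_ge k 2 with h | hk2
  · obtain rfl : k = 1 := by omega
    rw [Nat.cast_one] at hγ
    obtain ⟨g, hg0, hg1, hgγ⟩ : ∃ g : ℝ, 0 < g ∧ g < 1 ∧ γ < g := by
      obtain ⟨g, h1, h2⟩ := exists_between (max_lt hγ one_pos)
      exact ⟨g, (le_max_right _ _).trans_lt h1, h2, (le_max_left _ _).trans_lt h1⟩
    have hvg : ∀ c : ℝ, ∀ᶠ u : ℝ in atTop, c * Real.log u ^ g ≤ Real.log u := by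
      intro c
      filter_upwards [Real.tendsto_log_atTop.eventually
        (eventually_const_le_rpow (by linarith : 0 < 1 - g) c),
        Real.tendsto_log_atTop.eventually (eventually_gt_atTop 0)] with u h1 h2
      calc c * Real.log u ^ g ≤ Real.log u ^ (1 - g) * Real.log u ^ g :=
            mul_le_mul_of_nonneg_right h1 (by positivity)
        _ = Real.log u := by rw [← Real.rpow_add h2]; simp
    -- For `k = 1` the saving is `v ^ g / u`: `g > γ` gives the domination, and `g < 1` makes `y ^ δ
    -- = exp (v ^ g)` smaller than any fixed positive power of `u = exp v`.
    refine ⟨fun n => Real.log (Real.log (Real.log n)) ^ g / Real.log (Real.log n), ?_, ?_, ?_, ?_⟩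
    · filter_upwards [hu.eventually (hvg 1), hu.eventually (eventually_gt_atTop 0),
        hu.eventually (eventually_mul_log_add_le_rpow one_pos 4 0)] with n h1 h2 h3
      rw [Real.rpow_one] at h3
      rw [div_le_iff₀ h2]
      linarith
    · filter_upwards [hu.eventually (eventually_ge_atTop 3), hy.eventually (eventually_gt_atTop 0),
        hy.eventually (eventually_mul_log_add_le_rpow (by norm_num : (0 : ℝ) < 1 / 4) 1 0)]
        with n h1 h2 h3
      have hl := one_le_log_of_three_le h1
      have h4 : 1 ≤ Real.log (Real.log (Real.log n)) ^ g := Real.one_le_rpow hl hg0.le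
      rw [div_mul_eq_mul_div, le_div_iff₀ (by linarith)]
      calc _ ≤ Real.log n ^ (3 / 4 : ℝ) * Real.log n ^ (1 / 4 : ℝ) :=
            mul_le_mul_of_nonneg_left (by linarith) (by positivity)
        _ = 1 * Real.log n := by rw [← Real.rpow_add h2]; norm_num
        _ ≤ _ := mul_le_mul_of_nonneg_right h4 h2.le
    · intro K
      filter_upwards [hu.eventually (eventually_ge_atTop 3), hu.eventually
        (Real.tendsto_log_atTop.eventually
          (eventually_const_le_rpow (by linarith : 0 < g - γ) K))] with n h1 h2
      have hl := one_le_log_of_three_le h1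
      rw [pow_one, ← mul_div_assoc]
      refine div_le_div_of_nonneg_right ?_ (by linarith)
      calc _ ≤ Real.log (Real.log (Real.log n)) ^ (g - γ) * Real.log (Real.log (Real.log n)) ^ γ :=
            mul_le_mul_of_nonneg_right h2 (by positivity)
        _ = _ := by rw [← Real.rpow_add (by linarith)]; simp
    · intro B
      set B' := max B 1 with hB'
      have hB1 : 1 ≤ B' := le_max_right _ _
      have hpoly : ∀ᶠ u : ℝ in atTop, u * (4 * (1 + 4 * B' * u)) + 1 ≤ Real.exp (u / 8) := by
        filter_upwards [(tendsto_exp_mul_div_rpow_atTop 2 (1 / 8) (by norm_num)).eventually_ge_atTop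
          (5 + 16 * B'), eventually_ge_atTop 1] with u h1 h2
        rw [le_div_iff₀ (by positivity)] at h1
        rw [Real.rpow_two] at h1
        rw [show u / 8 = 1 / 8 * u by ring]
        nlinarith
      filter_upwards [hu.eventually (hvg 4), hu.eventually (hvg (2 * B')),
        hu.eventually (eventually_ge_atTop 16),
        hu.eventually (eventually_mul_log_add_le_rpow one_pos 4 0),
        hu.eventually (Real.tendsto_log_atTop.eventually
          (eventually_mul_log_add_le_rpow one_pos 2 (2 * Real.log 448))),
        hu.eventually hpoly, hy.eventually (eventually_ge_atTop 1)]
        with n a1 a2 a3 a4 a5 a6 a7 Q X hQ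
      set y := Real.log n
      set u := Real.log y
      set v := Real.log u
      have hu0 : 0 < u := by linarith
      have hy0 : 0 < y := by linarith
      have hv1 : 1 ≤ v := one_le_log_of_three_le (by linarith)
      rw [Real.rpow_one] at a4 a5
      have hyu : y = Real.exp u := (Real.exp_log hy0).symm
      have huv : u = Real.exp v := (Real.exp_log hu0).symm
      have hδ0 : 0 ≤ v ^ g / u := by positivity
      have hδ1 : v ^ g / u ≤ 1 / 4 := by
        rw [div_le_iff₀ hu0]; linarith
      have hF0 : ∑ d ∈ n.divisors, (d : ℝ) ^ (-(1 - v ^ g / u)) ≤ Real.exp (u / 8) := by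
        refine (sum_rpow_divisors_le a7 (by linarith) (by linarith)).trans ?_
        rw [Real.exp_le_exp, sub_sub_cancel]
        change 4 * (y ^ (v ^ g / u) * (4 * (1 + Real.log (1 + 2 * u)) + 2)) ≤ u / 8
        have h1 : y ^ (v ^ g / u) = Real.exp (v ^ g) := by
          rw [Real.rpow_def_of_pos hy0]
          change Real.exp (u * (v ^ g / u)) = _
          rw [mul_div_cancel₀ _ hu0.ne']
        have h2 := log_one_add_two_mul_le (by linarith : 3 ≤ u)
        have h3 : Real.exp (v ^ g) * (448 * v) ≤ u := by
          have hlv : 448 * v = Real.exp (Real.log (448 * v)) :=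
            (Real.exp_log (by linarith)).symm
          rw [hlv, ← Real.exp_add, huv, Real.exp_le_exp,
            Real.log_mul (by norm_num) (by linarith)]
          linarith
        rw [h1]
        have h4 : Real.exp (v ^ g) * (4 * (1 + Real.log (1 + 2 * u)) + 2) ≤
            Real.exp (v ^ g) * (14 * v) :=
          mul_le_mul_of_nonneg_left (by linarith) (Real.exp_pos _).le
        linarith
      -- The cutoff is `Z = y ^ (2 * B')`, whose `3/4` power exceeds `y ^ B`, while `Z ^ δ = exp (2
      -- * B' * v ^ g)` stays below `u`. No exponent is lost (`s = t`), because the divisor sum is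
      -- already at most `exp (u / 8)` and the target is `exp (exp (u / 2))`.
      have hQZ : (Q.card : ℝ) ≤ (Real.exp (2 * B' * u)) ^ (3 / 4 : ℝ) := by
        refine hQ.trans ?_
        rw [Real.rpow_def_of_pos hy0, ← Real.exp_mul, Real.exp_le_exp]
        have : B ≤ B' := le_max_left _ _
        nlinarith
      refine (sum_rpow_chainSet_succ_le (s := 1 - v ^ g / u) (Real.one_le_exp (by positivity)) hQZ
        (by linarith) (by linarith) (by linarith) le_rfl).trans ?_
      rw [Real.exp_le_exp, Real.log_exp, ← Real.exp_mul, sub_sub_cancel, sub_self, neg_zero,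
        Real.rpow_zero, one_mul, chainSet]
      have h1 : Real.exp (2 * B' * u * (v ^ g / u)) ≤ u := by
        rw [show 2 * B' * u * (v ^ g / u) = 2 * B' * v ^ g by field_simp]
        calc _ ≤ Real.exp v := Real.exp_le_exp.mpr a2
          _ = u := huv.symm
      have h2 : Real.log (1 + 2 * (2 * B' * u)) ≤ 4 * B' * u := by
        have := Real.log_le_sub_one_of_pos (by positivity : 0 < 1 + 2 * (2 * B' * u))
        linarith
      have h2' : 0 ≤ Real.log (1 + 2 * (2 * B' * u)) := Real.log_nonneg (by nlinarith)
      have h3 : Real.exp (2 * B' * u * (v ^ g / u)) *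
          (4 * (1 + Real.log (1 + 2 * (2 * B' * u)))) ≤ u * (4 * (1 + 4 * B' * u)) :=
        mul_le_mul h1 (by linarith) (by linarith) hu0.le
      have h4 : √y = Real.exp (u / 2) := by
        rw [Real.sqrt_eq_rpow, Real.rpow_def_of_pos hy0]
        congr 1
        change u * (1 / 2) = u / 2
        ring
      have h5 : 16 * Real.exp (u / 8) ≤ Real.exp (u / 2) := by
        have : Real.exp (u / 2) = Real.exp (3 * u / 8) * Real.exp (u / 8) := by
          rw [← Real.exp_add]; ring_nf
        rw [this]
        refine mul_le_mul_of_nonneg_right ?_ (Real.exp_pos _).le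
        have e6 := Real.add_one_le_exp (1 : ℝ)
        calc (16 : ℝ) ≤ (Real.exp 1) ^ 6 := by
              have := pow_le_pow_left₀ (by norm_num) e6 6
              norm_num at this ⊢
              linarith
          _ = Real.exp 6 := by rw [← Real.exp_nat_mul]; norm_num
          _ ≤ _ := Real.exp_le_exp.mpr (by linarith)
      rw [h4]
      linarith
  · have hk2' : (2 : ℝ) ≤ k := by exact_mod_cast hk2
    -- Any exponent strictly between 1 and 2 would do: above 1 for `eventually_sum_chainSet_le`,
    -- below `2 ≤ k` so that no power of `v` matters.
    refine ⟨fun n => Real.log (Real.log n) ^ (-(3 / 2) : ℝ), ?_, ?_, ?_, ?_⟩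
    · filter_upwards [hu.eventually (eventually_gt_atTop 0),
        hu.eventually (eventually_const_le_rpow (by norm_num : (0 : ℝ) < 3 / 2) 4)] with n h1 h2
      rw [Real.rpow_neg h1.le, inv_le_comm₀ (by linarith) (by norm_num)]
      linarith
    · filter_upwards [hu.eventually (eventually_gt_atTop 0), hy.eventually (eventually_gt_atTop 0),
        hy.eventually (eventually_mul_log_add_le_rpow (by norm_num : (0 : ℝ) < 1 / 6) 1 0)]
        with n h1 h2 h3
      rw [Real.rpow_neg h1.le, inv_mul_eq_div, le_div_iff₀ (by positivity)]
      calc _ ≤ Real.log n ^ (3 / 4 : ℝ) * (Real.log n ^ (1 / 6 : ℝ)) ^ (3 / 2 : ℝ) := by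
            refine mul_le_mul_of_nonneg_left ?_ (by positivity)
            exact Real.rpow_le_rpow h1.le (by linarith) (by norm_num)
        _ = Real.log n := by
            rw [← Real.rpow_mul h2.le, ← Real.rpow_add h2]; norm_num
    · intro K
      set K' := max K 1
      have hK' : 0 < K' := lt_of_lt_of_le one_pos (le_max_right _ _)
      set g := max γ 1
      have hg : 0 < g := lt_of_lt_of_le one_pos (le_max_right _ _)
      have hlog : ∀ᶠ u : ℝ in atTop, K' * Real.log u ^ g ≤ u ^ (1 / 2 : ℝ) := by
        filter_upwards [eventually_mul_log_add_le_rpow (by positivity : 0 < 1 / (2 * g))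
          (K' ^ (1 / g)) 0, eventually_ge_atTop 3] with u h1 h2
        have hl := one_le_log_of_three_le h2
        have h3 : (K' ^ (1 / g) * Real.log u) ^ g ≤ (u ^ (1 / (2 * g))) ^ g :=
          Real.rpow_le_rpow (by positivity) (by linarith) hg.le
        rw [Real.mul_rpow (by positivity) (by linarith), ← Real.rpow_mul hK'.le,
          ← Real.rpow_mul (by linarith), one_div_mul_cancel hg.ne', Real.rpow_one] at h3
        convert h3 using 2
        field_simp
      filter_upwards [hu.eventually (eventually_ge_atTop 3), hu.eventually hlog] with n h1 h2
      set u := Real.log (Real.log n)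
      have hu0 : 0 < u := by linarith
      have hl := one_le_log_of_three_le h1
      rw [← mul_div_assoc, div_le_iff₀ (by positivity)]
      calc K * Real.log u ^ γ ≤ K' * Real.log u ^ g := by
            refine mul_le_mul (le_max_left _ _) ?_ (by positivity) hK'.le
            exact Real.rpow_le_rpow_of_exponent_le hl (le_max_left _ _)
        _ ≤ u ^ (1 / 2 : ℝ) := h2
        _ ≤ u ^ (-(3 / 2) + (k : ℝ)) :=
            Real.rpow_le_rpow_of_exponent_le (by linarith) (by linarith)
        _ = _ := by rw [Real.rpow_add hu0, Real.rpow_natCast]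
    · intro B
      obtain ⟨C, hC⟩ := eventually_sum_chainSet_le k B (3 / 2) (by norm_num)
      filter_upwards [hC, hu.eventually (eventually_ge_atTop 3),
        hy.eventually (eventually_gt_atTop 0),
        hu.eventually (eventually_mul_log_add_le_rpow one_pos C 0),
        hy.eventually (eventually_mul_log_add_le_rpow (by norm_num : (0 : ℝ) < 1 / 2) 1 0)]
        with n h1 h2 h3 h4 h5 Q X hQ
      refine (h1 Q X hQ).trans ?_
      rw [Real.rpow_def_of_pos (by linarith : 0 < Real.log (Real.log n)), Real.exp_le_exp,
        Real.sqrt_eq_rpow]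
      rw [Real.rpow_one] at h4
      linarith

/-! ### Rankin's inequality and the totient case. -/

theorem card_le_rpow_mul_sum {M A : Finset ℕ} {Y c : ℝ} (hMA : M ⊆ A) (hc : 0 ≤ c) (hY : 0 ≤ Y)
    (hM : ∀ m ∈ M, 0 < m ∧ (m : ℝ) ≤ Y) :
    (M.card : ℝ) ≤ Y ^ c * ∑ d ∈ A, (d : ℝ) ^ (-c) := by
  calc (M.card : ℝ) = ∑ m ∈ M, (1 : ℝ) := by simp
    _ ≤ ∑ m ∈ M, Y ^ c * (m : ℝ) ^ (-c) := by
        refine Finset.sum_le_sum fun m hm => ?_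
        obtain ⟨h1, h2⟩ := hM m hm
        have h1' : (0 : ℝ) < m := by exact_mod_cast h1
        rw [Real.rpow_neg h1'.le, ← div_eq_mul_inv, one_le_div (by positivity)]
        exact Real.rpow_le_rpow h1'.le h2 hc
    _ ≤ _ := by
        rw [← Finset.mul_sum]
        refine mul_le_mul_of_nonneg_left ?_ (by positivity)
        exact Finset.sum_le_sum_of_subset_of_nonneg hMA fun d _ _ => by positivity

/-- The `i`-th smallest element of `P` is at least `i + 1`, so the product dominates a telescoping
one. -/
theorem inv_card_add_one_le_prod_one_sub_inv (P : Finset ℕ) (hP : ∀ p ∈ P, 2 ≤ p) :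
    ((P.card : ℝ) + 1)⁻¹ ≤ ∏ p ∈ P, (1 - (p : ℝ)⁻¹) := by
  induction P using Finset.induction_on_max with
  | empty => simp
  | insert a s hs ih =>
    have has : a ∉ s := fun h => (hs a h).false
    rw [Finset.prod_insert has, Finset.card_insert_of_notMem has]
    have hcard : s.card + 2 ≤ a := by
      have hsub : s ⊆ Finset.Ico 2 a := fun x hx =>
        Finset.mem_Ico.mpr ⟨hP x (Finset.mem_insert_of_mem hx), hs x hx⟩
      have h1 := Finset.card_le_card hsub
      have h2 := hP a (Finset.mem_insert_self a s)
      rw [Nat.card_Ico] at h1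
      omega
    have hc : ((s.card : ℝ) + 2) ≤ a := by exact_mod_cast hcard
    have hs0 : (0 : ℝ) ≤ s.card := Nat.cast_nonneg _
    have h1 : (1 - ((s.card : ℝ) + 2)⁻¹) ≤ 1 - (a : ℝ)⁻¹ := by
      have := inv_anti₀ (by linarith) hc
      linarith
    calc (((s.card + 1 : ℕ) : ℝ) + 1)⁻¹
        = (1 - ((s.card : ℝ) + 2)⁻¹) * ((s.card : ℝ) + 1)⁻¹ := by
          push_cast; field_simp; ring
      _ ≤ _ := by
          have h3 : 0 ≤ 1 - ((s.card : ℝ) + 2)⁻¹ := by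
            have : ((s.card : ℝ) + 2)⁻¹ ≤ 1 := inv_le_one_of_one_le₀ (by linarith)
            linarith
          exact mul_le_mul h1 (ih fun p hp => hP p (Finset.mem_insert_of_mem hp))
            (by positivity) (h3.trans h1)

theorem le_totient_mul_log {m : ℕ} (hm : 0 < m) :
    (m : ℝ) ≤ Nat.totient m * (2 * Real.log m + 1) := by
  have h1 : (Nat.totient m : ℝ) = m * ∏ p ∈ m.primeFactors, (1 - (p : ℝ)⁻¹) := by
    have h := congrArg (fun q : ℚ => (q : ℝ)) (Nat.totient_eq_mul_prod_factors m)
    push_cast at h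
    exact h
  have h2 := inv_card_add_one_le_prod_one_sub_inv m.primeFactors
    fun p hp => (Nat.prime_of_mem_primeFactors hp).two_le
  have h3 := card_primeFactors_le_log hm.ne'
  have hm0 : (0 : ℝ) < m := by exact_mod_cast hm
  have hc : (0 : ℝ) ≤ m.primeFactors.card := Nat.cast_nonneg _
  calc (m : ℝ) = m * ((m.primeFactors.card : ℝ) + 1)⁻¹ * (m.primeFactors.card + 1) := by
        field_simp
    _ ≤ Nat.totient m * (2 * Real.log m + 1) := by
        refine mul_le_mul ?_ (by linarith) (by positivity) (by positivity)
        rw [h1]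
        exact mul_le_mul_of_nonneg_left h2 hm0.le

/-- Bootstrapping from `m ≤ y * (2 * log m + 1)`: the crude bound `2 * log m + 1 ≤ 4 * √m` gives `m
≤ 16 * y ^ 2 ≤ y ^ 4`, and feeding `log m ≤ 4 * log y` back in gives the claim. -/
theorem le_mul_log_of_totient_le {m : ℕ} {y : ℝ} (hm : 0 < m) (hy : 4 ≤ y)
    (h : (Nat.totient m : ℝ) ≤ y) : (m : ℝ) ≤ 9 * y * Real.log y := by
  have hm0 : (1 : ℝ) ≤ m := by exact_mod_cast hm
  have h1 := le_totient_mul_log hm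
  have hlm : 0 ≤ Real.log m := Real.log_nonneg hm0
  have h2 : (m : ℝ) ≤ y * (2 * Real.log m + 1) :=
    h1.trans (mul_le_mul_of_nonneg_right h (by linarith))
  have hs : 0 < √(m : ℝ) := Real.sqrt_pos.mpr (by linarith)
  have hss : √(m : ℝ) * √(m : ℝ) = m := Real.mul_self_sqrt (by linarith)
  have h3 : 2 * Real.log m + 1 ≤ 4 * √(m : ℝ) := by
    have : Real.log m = 2 * Real.log √(m : ℝ) := by
      rw [Real.log_sqrt (by linarith)]; ring
    have := Real.log_le_sub_one_of_pos hs
    linarith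
  have h4 : √(m : ℝ) ≤ 4 * y := by
    have : √(m : ℝ) * √(m : ℝ) ≤ (4 * y) * √(m : ℝ) := by nlinarith
    exact le_of_mul_le_mul_right this hs
  have h5 : Real.log m ≤ 4 * Real.log y := by
    have h6 : (m : ℝ) ≤ y ^ 4 := by
      have h8 : (m : ℝ) ≤ (4 * y) * (4 * y) := by rw [← hss]; gcongr
      have h9 : (4 * y) * (4 * y) ≤ (y * y) * (y * y) := by gcongr
      calc (m : ℝ) ≤ (y * y) * (y * y) := h8.trans h9
        _ = y ^ 4 := by ring
    have := Real.log_le_log (by linarith) h6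
    rwa [Real.log_pow] at this
  have h7 : 1 ≤ Real.log y := one_le_log_of_three_le (by linarith)
  nlinarith

theorem eventually_le_of_totient_iterate_eq (k : ℕ) : ∃ C : ℕ, ∀ᶠ n : ℕ in atTop,
    ∀ m, 0 < m → Nat.totient^[k] m = n → (m : ℝ) ≤ n * Real.log n ^ C := by
  induction k with
  | zero => exact ⟨0, Eventually.of_forall fun n m _ h => by simp_all⟩
  | succ k ih =>
    obtain ⟨C, hC⟩ := ih
    refine ⟨C + 2, ?_⟩
    filter_upwards [hC, tendsto_log_natCast.eventually (eventually_ge_atTop 18),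
      tendsto_log_natCast.eventually (eventually_mul_log_add_le_rpow one_pos C 0),
      eventually_ge_atTop 4] with n h1 h2 h3 h4 m hm hmn
    rw [Function.iterate_succ_apply] at hmn
    have h5 := h1 _ (Nat.totient_pos.mpr hm) hmn
    have hn4 : (4 : ℝ) ≤ n := by exact_mod_cast h4
    set y := Real.log n
    have hp : 1 ≤ y ^ C := one_le_pow₀ (by linarith)
    have h6 := le_mul_log_of_totient_le hm (by nlinarith : 4 ≤ n * y ^ C) h5
    rw [Real.rpow_one] at h3
    have h7 : Real.log (n * y ^ C) ≤ 2 * y := by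
      rw [Real.log_mul (by linarith) (by positivity), Real.log_pow]
      linarith
    calc (m : ℝ) ≤ 9 * (n * y ^ C) * Real.log (n * y ^ C) := h6
      _ ≤ 9 * (n * y ^ C) * (2 * y) := mul_le_mul_of_nonneg_left h7 (by positivity)
      _ = n * y ^ (C + 1) * 18 := by ring
      _ ≤ n * y ^ (C + 1) * y := mul_le_mul_of_nonneg_left h2 (by positivity)
      _ = n * y ^ (C + 2) := by ring

theorem totient_iterate_pos_le {m : ℕ} (hm : 0 < m) (i : ℕ) :
    0 < Nat.totient^[i] m ∧ Nat.totient^[i] m ≤ m := by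
  induction i with
  | zero => exact ⟨hm, le_rfl⟩
  | succ i ih =>
    rw [Function.iterate_succ_apply']
    exact ⟨Nat.totient_pos.mpr ih.1, (Nat.totient_le _).trans ih.2⟩

theorem sub_one_dvd_totient_of_prime_dvd {q m : ℕ} (hq : q.Prime) (h : q ∣ m) :
    q - 1 ∣ Nat.totient m := by
  rw [← Nat.totient_prime hq]
  exact Nat.totient_dvd_of_dvd h

theorem eventually_log_add_sqrt_le (C : ℝ) :
    ∀ᶠ y : ℝ in atTop, C * Real.log y + √y ≤ y ^ (3 / 4 : ℝ) / 2 := by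
  filter_upwards [eventually_mul_log_add_le_rpow (by norm_num : (0 : ℝ) < 3 / 4) (4 * C) 0,
    eventually_const_le_rpow (by norm_num : (0 : ℝ) < 1 / 4) 4, eventually_gt_atTop 0]
    with y h1 h2 h3
  have : 4 * √y ≤ y ^ (3 / 4 : ℝ) := by
    rw [Real.sqrt_eq_rpow]
    calc _ ≤ y ^ (1 / 4 : ℝ) * y ^ (1 / 2 : ℝ) :=
          mul_le_mul_of_nonneg_right h2 (by positivity)
      _ = _ := by rw [← Real.rpow_add h3]; norm_num
  linarith

/-- Rankin's inequality with no exceptional primes. Half of `δ * y ≥ y ^ (3/4)` pays for both the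
polylogarithmic size of `m / n` and the factor `exp √y`. -/
theorem totient_count_le {k : ℕ} {δ : ℕ → ℝ} (hδ : ∀ᶠ n in atTop, δ n ≤ 1 / 4)
    (hδ' : ∀ᶠ n : ℕ in atTop, Real.log n ^ (3 / 4 : ℝ) ≤ δ n * Real.log n)
    (hsum : ∀ B : ℝ, ∀ᶠ n : ℕ in atTop, ∀ (Q : Finset ℕ) (X : ℕ), (Q.card : ℝ) ≤ Real.log n ^ B →
        ∑ d ∈ chainSet Q X n k, (d : ℝ) ^ (-(1 - δ n)) ≤ Real.exp (√(Real.log n))) :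
    ∃ c : ℝ, 0 < c ∧ ∀ᶠ n : ℕ in atTop, (iteratePreimage Nat.totient k n).Finite ∧
      (iteratePreimageCount Nat.totient k n : ℝ) ≤ n * Real.exp (-(c * (δ n * Real.log n))) := by
  obtain ⟨C, hC⟩ := eventually_le_of_totient_iterate_eq k
  refine ⟨1 / 2, by norm_num, ?_⟩
  filter_upwards [hδ, hδ', hsum 0, hC, eventually_ge_atTop 1,
    tendsto_log_natCast.eventually (eventually_ge_atTop 1),
    tendsto_log_natCast.eventually (eventually_log_add_sqrt_le C)] with n h1 h2 h3 h4 h5 h6 h7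
  set y := Real.log n with hy
  have hn0 : (0 : ℝ) < n := by exact_mod_cast h5
  set X := ⌊(n : ℝ) * y ^ C⌋₊
  set M := (Finset.Icc 1 X).filter (fun m => Nat.totient^[k] m = n) with hM
  have hset : iteratePreimage Nat.totient k n = M := by
    ext m
    simp only [iteratePreimage, Set.mem_ofPred_eq, hM, Finset.coe_filter, Finset.mem_Icc]
    refine ⟨fun h => ⟨⟨h.1, Nat.le_floor (h4 m h.1 h.2)⟩, h.2⟩, fun h => ⟨h.1.1, h.2⟩⟩
  refine ⟨hset ▸ M.finite_toSet, ?_⟩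
  rw [iteratePreimageCount, hset, Set.ncard_coe_finset]
  have hsub : M ⊆ chainSet ∅ X n k := by
    intro m hm
    obtain ⟨hm1, hm2⟩ := Finset.mem_filter.mp hm
    obtain ⟨hm3, hm4⟩ := Finset.mem_Icc.mp hm1
    refine iterate_mem_chainSet h5 hm2 (fun i _ => ?_) fun i _ q hq hqd => ?_
    · exact ⟨(totient_iterate_pos_le hm3 i).1, (totient_iterate_pos_le hm3 i).2.trans hm4⟩
    · right; left
      rw [Function.iterate_succ_apply']
      exact sub_one_dvd_totient_of_prime_dvd hq hqd
  have hy0 : 0 < y := by linarith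
  have hδ0 : 0 ≤ δ n := by
    have : 0 ≤ δ n * y := le_trans (by positivity) h2
    exact nonneg_of_mul_nonneg_left this hy0
  have hcard := card_le_rpow_mul_sum (Y := n * y ^ C) (c := 1 - δ n) hsub (by linarith)
    (by positivity) fun m hm => by
    have hm1 := Finset.mem_Icc.mp (Finset.mem_filter.mp hm).1
    exact ⟨hm1.1, (Nat.le_floor_iff (by positivity)).mp hm1.2⟩
  refine hcard.trans ?_
  have hs := h3 ∅ X (by simp)
  calc _ ≤ (n * y ^ C) ^ (1 - δ n) * Real.exp √y :=
        mul_le_mul_of_nonneg_left hs (by positivity)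
    _ ≤ (Real.exp (y * (1 - δ n)) * Real.exp (C * Real.log y)) * Real.exp √y := by
        refine mul_le_mul_of_nonneg_right ?_ (Real.exp_pos _).le
        rw [Real.mul_rpow hn0.le (by positivity), Real.rpow_def_of_pos hn0]
        refine mul_le_mul_of_nonneg_left ?_ (Real.exp_pos _).le
        have hyC : Real.exp (C * Real.log y) = y ^ C := by
          rw [← Real.log_pow, Real.exp_log (by positivity)]
        rw [hyC]
        exact Real.rpow_le_self_of_one_le (one_le_pow₀ h6) (by linarith)
    _ ≤ Real.exp y * Real.exp (-(1 / 2 * (δ n * y))) := by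
        rw [← Real.exp_add, ← Real.exp_add, ← Real.exp_add, Real.exp_le_exp]
        linarith
    _ = _ := by rw [hy, Real.exp_log hn0]

/-! ### The sum-of-divisors case: square parts and exceptional primes. -/

open ArithmeticFunction.Omega

/-- The sum-of-divisors function as a plain function. -/
abbrev sigmaOne : ℕ → ℕ := fun m => ArithmeticFunction.sigma 1 m

theorem sigmaOne_pos {m : ℕ} (hm : 0 < m) : 0 < sigmaOne m :=
  ArithmeticFunction.sigma_pos 1 m hm.ne'

theorem le_sigmaOne {m : ℕ} (hm : 0 < m) : m ≤ sigmaOne m := by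
  rw [sigmaOne, ArithmeticFunction.sigma_one_apply]
  exact Finset.single_le_sum (f := fun d => d) (fun _ _ => Nat.zero_le _)
    (Nat.mem_divisors_self m hm.ne')

theorem sigmaOne_prime {q : ℕ} (hq : q.Prime) : sigmaOne q = q + 1 := by
  have := ArithmeticFunction.sigma_one_apply_prime_pow (i := 1) hq
  simpa [Finset.sum_range_succ, add_comm] using this

theorem sigmaOne_iterate_mono {m i k : ℕ} (hm : 0 < m) (hik : i ≤ k) :
    0 < sigmaOne^[i] m ∧ sigmaOne^[i] m ≤ sigmaOne^[k] m := by
  have hpos : ∀ l, 0 < sigmaOne^[l] m := by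
    intro l
    induction l with
    | zero => exact hm
    | succ l ih => rw [Function.iterate_succ_apply']; exact sigmaOne_pos ih
  refine ⟨hpos i, ?_⟩
  have hmono : Monotone fun l => sigmaOne^[l] m := monotone_nat_of_le_succ fun l => by
    rw [Function.iterate_succ_apply']; exact le_sigmaOne (hpos l)
  exact hmono hik

theorem sigmaOne_eq_prod {j : ℕ} (hj : j ≠ 0) :
    sigmaOne j = ∏ r ∈ j.primeFactors, sigmaOne (r ^ j.factorization r) :=
  ArithmeticFunction.isMultiplicative_sigma.multiplicative_factorization _ hj

theorem factorization_eq_one_of_not_sq_dvd {j r : ℕ} (hj : j ≠ 0) (hr : r ∈ j.primeFactors)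
    (h : ¬ r ^ 2 ∣ j) : j.factorization r = 1 := by
  have hp := Nat.prime_of_mem_primeFactors hr
  have h1 := hp.factorization_pos_of_dvd hj (Nat.dvd_of_mem_primeFactors hr)
  have h2 : ¬ 2 ≤ j.factorization r := fun h2 =>
    h ((hp.pow_dvd_iff_le_factorization hj).mpr h2)
  omega

theorem add_one_dvd_sigmaOne {j q : ℕ} (hj : j ≠ 0) (hq : q.Prime) (hqj : q ∣ j)
    (h : ¬ q ^ 2 ∣ j) : q + 1 ∣ sigmaOne j := by
  have hmem : q ∈ j.primeFactors := Nat.mem_primeFactors.mpr ⟨hq, hqj, hj⟩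
  rw [sigmaOne_eq_prod hj, ← sigmaOne_prime hq]
  have := Finset.dvd_prod_of_mem (fun r => sigmaOne (r ^ j.factorization r)) hmem
  rwa [factorization_eq_one_of_not_sq_dvd hj hmem h, pow_one] at this

/-- The product of the primes outside `S` whose square divides `j`. -/
noncomputable def squarePart (S : Finset ℕ) (j : ℕ) : ℕ :=
  ∏ q ∈ j.primeFactors with q ∉ S ∧ q ^ 2 ∣ j, q

theorem prime_dvd_squarePart_iff {S : Finset ℕ} {j q : ℕ} (hj : j ≠ 0) (hq : q.Prime) :
    q ∣ squarePart S j ↔ q ∉ S ∧ q ^ 2 ∣ j := by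
  rw [squarePart, hq.prime.dvd_finsetProd_iff]
  constructor
  · rintro ⟨p, hp, hqp⟩
    obtain ⟨h1, h2⟩ := Finset.mem_filter.mp hp
    rwa [(Nat.prime_dvd_prime_iff_eq hq (Nat.prime_of_mem_primeFactors h1)).mp hqp]
  · intro h
    refine ⟨q, Finset.mem_filter.mpr ⟨Nat.mem_primeFactors.mpr ⟨hq, ?_, hj⟩, h⟩, dvd_rfl⟩
    exact (dvd_pow_self q two_ne_zero).trans h.2

theorem squarePart_pos (S : Finset ℕ) (j : ℕ) : 0 < squarePart S j :=
  Finset.prod_pos fun _ hq => Nat.pos_of_mem_primeFactors (Finset.mem_filter.mp hq).1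

theorem squarePart_sq_dvd (S : Finset ℕ) (j : ℕ) : squarePart S j ^ 2 ∣ j := by
  rw [squarePart, ← Finset.prod_pow]
  refine Finset.prod_dvd_of_isRelPrime ?_ fun q hq => (Finset.mem_filter.mp hq).2.2
  intro p hp q hq hpq
  have hp' := Nat.prime_of_mem_primeFactors (Finset.mem_filter.mp hp).1
  have hq' := Nat.prime_of_mem_primeFactors (Finset.mem_filter.mp hq).1
  exact Nat.coprime_iff_isRelPrime.mp
    (Nat.Coprime.pow 2 2 ((Nat.coprime_primes hp' hq').mpr hpq))

theorem squarePart_le {S : Finset ℕ} {j : ℕ} (hj : 0 < j) : squarePart S j ≤ j :=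
  (Nat.le_self_pow two_ne_zero _).trans (Nat.le_of_dvd hj (squarePart_sq_dvd S j))

open Finset in
/-- Primes up to `T` and those forced, along a sequence of square parts, by higher prime powers. -/
noncomputable def badPrimes (n T : ℕ) : List ℕ → Finset ℕ
  | [] => (range (T + 1)).filter Nat.Prime
  | v :: L => (badPrimes n T L ∪ v.primeFactors) ∪
      (badPrimes n T L ∪ v.primeFactors).biUnion fun r =>
        (range (Nat.log 2 n + 1)).biUnion fun e =>
          if sigmaOne (r ^ e) ≤ n then (sigmaOne (r ^ e)).primeFactors else ∅

/-- The square parts met by the iterates of the sum-of-divisors function starting from `m`. -/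
noncomputable def squareType (n T m : ℕ) : ℕ → List ℕ
  | 0 => []
  | i + 1 => squarePart (badPrimes n T (squareType n T m i)) (sigmaOne^[i] m) ::
      squareType n T m i

theorem badPrimes_subset_cons (n T v : ℕ) (L : List ℕ) :
    badPrimes n T L ⊆ badPrimes n T (v :: L) := by
  rw [badPrimes]
  exact Finset.subset_union_left.trans Finset.subset_union_left

theorem primeFactors_subset_badPrimes_cons (n T v : ℕ) (L : List ℕ) :
    v.primeFactors ⊆ badPrimes n T (v :: L) := by
  rw [badPrimes]
  exact Finset.subset_union_right.trans Finset.subset_union_left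

theorem badPrimes_squareType_mono {n T m i k : ℕ} (h : i ≤ k) :
    badPrimes n T (squareType n T m i) ⊆ badPrimes n T (squareType n T m k) := by
  have : Monotone fun l => badPrimes n T (squareType n T m l) := monotone_nat_of_le_succ fun l =>
    badPrimes_subset_cons n T _ _
  exact this h

theorem mem_badPrimes_of_le {n T q : ℕ} (hq : q.Prime) (h : q ≤ T) (L : List ℕ) :
    q ∈ badPrimes n T L := by
  induction L with
  | nil => simp [badPrimes, hq, Nat.lt_succ_of_le h]
  | cons v L ih => exact badPrimes_subset_cons n T v L ih

/-- The primes outside `S` that divide `j` exactly once. -/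
def simplePrimes (S : Finset ℕ) (j : ℕ) : Finset ℕ :=
  j.primeFactors.filter fun r => r ∉ S ∧ ¬ r ^ 2 ∣ j

/-- A factor `σ(r ^ e)` of `σ(j)` with `r` exceptional or `r ^ 2 ∣ j` has all its primes in the next
exceptional set, hence is coprime to `w`. The exponent satisfies `2 ^ e ≤ σ(r ^ e) ≤ n`, so the
finite range in `badPrimes` misses nothing. -/
theorem dvd_prod_simplePrimes {n T j w : ℕ} {L : List ℕ} (hj : 0 < j) (hjn : sigmaOne j ≤ n)
    (hw : w ∣ sigmaOne j)
    (hfree : ∀ q, q.Prime → q ∣ w →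
      q ∉ badPrimes n T (squarePart (badPrimes n T L) j :: L)) :
    w ∣ ∏ r ∈ simplePrimes (badPrimes n T L) j, (r + 1) := by
  set S := badPrimes n T L
  rw [sigmaOne_eq_prod hj.ne', ← Finset.prod_filter_mul_prod_filter_not j.primeFactors
    (fun r => r ∉ S ∧ ¬ r ^ 2 ∣ j)] at hw
  have h1 : ∏ r ∈ j.primeFactors with r ∉ S ∧ ¬ r ^ 2 ∣ j, sigmaOne (r ^ j.factorization r) =
      ∏ r ∈ simplePrimes S j, (r + 1) := by
    refine Finset.prod_congr rfl fun r hr => ?_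
    obtain ⟨hr1, -, hr2⟩ := Finset.mem_filter.mp hr
    rw [factorization_eq_one_of_not_sq_dvd hj.ne' hr1 hr2, pow_one,
      sigmaOne_prime (Nat.prime_of_mem_primeFactors hr1)]
  rw [h1] at hw
  refine Nat.Coprime.dvd_of_dvd_mul_right ?_ hw
  refine Nat.Coprime.prod_right fun r hr => ?_
  obtain ⟨hr1, hr2⟩ := Finset.mem_filter.mp hr
  have hrp := Nat.prime_of_mem_primeFactors hr1
  refine Nat.Coprime.symm (Nat.coprime_of_dvd fun q hq hq1 hq2 => hfree q hq hq2 ?_)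
  rw [badPrimes]
  refine Finset.mem_union_right _ (Finset.mem_biUnion.mpr ⟨r, ?_, ?_⟩)
  · rw [Finset.mem_union]
    by_cases hrS : r ∈ S
    · exact Or.inl hrS
    · right
      refine Nat.mem_primeFactors.mpr ⟨hrp, ?_, (squarePart_pos S j).ne'⟩
      rw [prime_dvd_squarePart_iff hj.ne' hrp]
      exact ⟨hrS, by tauto⟩
  · have hdvd : r ^ j.factorization r ∣ j := Nat.ordProj_dvd j r
    have hle : sigmaOne (r ^ j.factorization r) ≤ n := by
      refine le_trans (Nat.le_of_dvd (sigmaOne_pos hj) ?_) hjn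
      rw [sigmaOne_eq_prod hj.ne']
      exact Finset.dvd_prod_of_mem (fun r => sigmaOne (r ^ j.factorization r)) hr1
    refine Finset.mem_biUnion.mpr ⟨j.factorization r, ?_, ?_⟩
    · rw [Finset.mem_range, Nat.lt_succ_iff]
      refine Nat.le_log_of_pow_le one_lt_two ?_
      calc 2 ^ j.factorization r ≤ r ^ j.factorization r := Nat.pow_le_pow_left hrp.two_le _
        _ ≤ sigmaOne (r ^ j.factorization r) := le_sigmaOne (pow_pos hrp.pos _)
        _ ≤ n := hle
    · rw [if_pos hle]
      exact Nat.mem_primeFactors.mpr ⟨hq, hq1, (sigmaOne_pos (pow_pos hrp.pos _)).ne'⟩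

/-! ### Reciprocal sums over `m` with a prescribed divisor of an iterate. -/

theorem sum_divisors_pow_cardFactors_le {x : ℝ} (hx : 0 ≤ x) (w : ℕ) :
    ∑ g ∈ w.divisors, x ^ Ω g ≤ (1 + x) ^ Ω w := by
  induction w using induction_on_primes with
  | zero => simp
  | one => simp
  | prime_mul p a hp ih =>
    rcases eq_or_ne a 0 with rfl | ha
    · simp
    have hsub : (p * a).divisors ⊆ a.divisors ∪ a.divisors.image (p * ·) := by
      intro d hd
      have hda := Nat.dvd_of_mem_divisors hd
      rw [Finset.mem_union]
      by_cases hpd : p ∣ d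
      · right
        obtain ⟨e, rfl⟩ := hpd
        refine Finset.mem_image.mpr ⟨e, Nat.mem_divisors.mpr ⟨?_, ha⟩, rfl⟩
        exact Nat.dvd_of_mul_dvd_mul_left hp.pos hda
      · left
        refine Nat.mem_divisors.mpr ⟨?_, ha⟩
        exact Nat.Coprime.dvd_of_dvd_mul_left ((hp.coprime_iff_not_dvd.mpr hpd).symm) hda
    have h2 : ∑ g ∈ a.divisors.image (p * ·), x ^ Ω g = x * ∑ g ∈ a.divisors, x ^ Ω g := by
      rw [Finset.sum_image (fun _ _ _ _ h => Nat.eq_of_mul_eq_mul_left hp.pos h), Finset.mul_sum]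
      refine Finset.sum_congr rfl fun g hg => ?_
      rw [ArithmeticFunction.cardFactors_mul hp.ne_zero (Nat.pos_of_mem_divisors hg).ne',
        ArithmeticFunction.cardFactors_apply_prime hp]
      ring
    calc ∑ g ∈ (p * a).divisors, x ^ Ω g
        ≤ ∑ g ∈ a.divisors ∪ a.divisors.image (p * ·), x ^ Ω g :=
          Finset.sum_le_sum_of_subset_of_nonneg hsub fun _ _ _ => by positivity
      _ ≤ ∑ g ∈ a.divisors, x ^ Ω g + ∑ g ∈ a.divisors.image (p * ·), x ^ Ω g := by
          rw [← Finset.sum_union_inter]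
          exact le_add_of_nonneg_right (Finset.sum_nonneg fun _ _ => by positivity)
      _ = (1 + x) * ∑ g ∈ a.divisors, x ^ Ω g := by rw [h2]; ring
      _ ≤ (1 + x) * (1 + x) ^ Ω a := mul_le_mul_of_nonneg_left ih (by linarith)
      _ = _ := by
          rw [ArithmeticFunction.cardFactors_mul hp.ne_zero ha,
            ArithmeticFunction.cardFactors_apply_prime hp]
          ring

theorem sum_inv_multiples_le {N w : ℕ} (hw : 0 < w) :
    ∑ m ∈ Finset.Icc 1 N with w ∣ m, (m : ℝ)⁻¹ ≤ (1 + Real.log N) / w := by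
  have hsub : (Finset.Icc 1 N).filter (w ∣ ·) ⊆ (Finset.Icc 1 N).image (w * ·) := by
    intro m hm
    obtain ⟨h1, t, rfl⟩ := Finset.mem_filter.mp hm
    obtain ⟨h1, h2⟩ := Finset.mem_Icc.mp h1
    refine Finset.mem_image.mpr ⟨t, Finset.mem_Icc.mpr ⟨Nat.pos_of_mul_pos_left h1, ?_⟩, rfl⟩
    nlinarith
  calc _ ≤ ∑ m ∈ (Finset.Icc 1 N).image (w * ·), (m : ℝ)⁻¹ :=
        Finset.sum_le_sum_of_subset_of_nonneg hsub fun _ _ _ => by positivity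
    _ = (∑ t ∈ Finset.Icc 1 N, (t : ℝ)⁻¹) / w := by
        rw [Finset.sum_image (fun _ _ _ _ h => Nat.eq_of_mul_eq_mul_left hw h), Finset.sum_div]
        refine Finset.sum_congr rfl fun t _ => ?_
        push_cast
        rw [mul_inv, div_eq_mul_inv, mul_comm]
    _ ≤ _ := by
        have := sum_inv_Icc_le N
        gcongr

theorem sum_inv_add_one_multiples_le {n g : ℕ} (hn : 0 < n) (hg : 0 < g) :
    ∑ r ∈ Finset.Icc 1 n with g ∣ r + 1, (r : ℝ)⁻¹ ≤ 2 * (2 + Real.log n) / g := by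
  have hn1 : (1 : ℝ) ≤ n := by exact_mod_cast hn
  calc _ ≤ ∑ r ∈ Finset.Icc 1 n with g ∣ r + 1, 2 * ((r + 1 : ℕ) : ℝ)⁻¹ := by
        refine Finset.sum_le_sum fun r hr => ?_
        have hr1 : (1 : ℝ) ≤ r := by
          exact_mod_cast (Finset.mem_Icc.mp (Finset.mem_filter.mp hr).1).1
        push_cast
        rw [← div_eq_mul_inv, inv_eq_one_div, div_le_div_iff₀ (by linarith) (by linarith)]
        linarith
    _ = 2 * ∑ m ∈ ((Finset.Icc 1 n).filter (g ∣ · + 1)).image (fun r : ℕ => r + 1), (m : ℝ)⁻¹ := by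
        rw [← Finset.mul_sum, Finset.sum_image (fun _ _ _ _ h => Nat.add_right_cancel h)]
    _ ≤ 2 * ∑ m ∈ Finset.Icc 1 (n + 1) with g ∣ m, (m : ℝ)⁻¹ := by
        refine mul_le_mul_of_nonneg_left ?_ (by norm_num)
        refine Finset.sum_le_sum_of_subset_of_nonneg ?_ fun _ _ _ => by positivity
        intro m hm
        obtain ⟨r, hr, rfl⟩ := Finset.mem_image.mp hm
        obtain ⟨h1, h2⟩ := Finset.mem_filter.mp hr
        have := (Finset.mem_Icc.mp h1)
        exact Finset.mem_filter.mpr ⟨Finset.mem_Icc.mpr ⟨by omega, by omega⟩, h2⟩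
    _ ≤ 2 * ((1 + Real.log (n + 1 : ℕ)) / g) :=
        mul_le_mul_of_nonneg_left (sum_inv_multiples_le hg) (by norm_num)
    _ ≤ _ := by
        rw [mul_div_assoc]
        refine mul_le_mul_of_nonneg_left ?_ (by norm_num)
        refine div_le_div_of_nonneg_right ?_ (Nat.cast_nonneg g)
        have h1 : Real.log (n + 1 : ℕ) ≤ Real.log (2 * n) :=
          Real.log_le_log (by positivity) (by push_cast; linarith)
        rw [Real.log_mul (by norm_num) (by linarith)] at h1
        linarith [Real.log_two_lt_d9]

theorem sum_le_sum_sum_of_cover {ι α : Type*} [DecidableEq α] {A : Finset α} {s : Finset ι}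
    {t : ι → Finset α} {f : α → ℝ} (hf : ∀ a, 0 ≤ f a) (h : ∀ a ∈ A, ∃ i ∈ s, a ∈ t i) :
    ∑ a ∈ A, f a ≤ ∑ i ∈ s, ∑ a ∈ t i, f a := by
  classical
  have h1 : A ⊆ s.biUnion t := fun a ha => Finset.mem_biUnion.mpr (h a ha)
  refine (Finset.sum_le_sum_of_subset_of_nonneg h1 fun a _ _ => hf a).trans ?_
  clear h1 h
  induction s using Finset.induction_on with
  | empty => simp
  | insert i s hi ih =>
    rw [Finset.biUnion_insert, Finset.sum_insert hi]
    calc _ ≤ ∑ a ∈ t i, f a + ∑ a ∈ s.biUnion t, f a := by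
          rw [← Finset.sum_union_inter]
          exact le_add_of_nonneg_right (Finset.sum_nonneg fun a _ => hf a)
      _ ≤ _ := by linarith

theorem dvd_prod_erase_of_dvd_prod {ι : Type*} [DecidableEq ι] {R : Finset ι} {f : ι → ℕ} {r : ι}
    {w : ℕ} (hr : r ∈ R) (hw : 0 < w) (h : w ∣ ∏ x ∈ R, f x) :
    w / w.gcd (f r) ∣ ∏ x ∈ R.erase r, f x := by
  rw [← Finset.mul_prod_erase R f hr] at h
  have hg : 0 < w.gcd (f r) := Nat.gcd_pos_of_pos_left _ hw
  refine Nat.Coprime.dvd_of_dvd_mul_left (Nat.coprime_div_gcd_div_gcd hg) ?_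
  have h1 : w.gcd (f r) * (w / w.gcd (f r)) ∣
      w.gcd (f r) * (f r / w.gcd (f r) * ∏ x ∈ R.erase r, f x) := by
    rw [Nat.mul_div_cancel' (Nat.gcd_dvd_left _ _), ← mul_assoc,
      Nat.mul_div_cancel' (Nat.gcd_dvd_right _ _)]
    exact h
  exact Nat.dvd_of_mul_dvd_mul_left hg h1

/-- From divisibility of `j m` to divisibility of the product of `r + 1` over its simple primes. -/
theorem sum_inv_dvd_prod_simplePrimes_le {M S : Finset ℕ} {j : ℕ → ℕ} {n N : ℕ} {A H H' : ℝ}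
    (hn : 0 < n) (hA : 0 ≤ A) (hH : 0 ≤ H) (hH' : 0 < H')
    (hj : ∀ m ∈ M, 0 < j m ∧ j m ≤ n)
    (hnum : 2 * H * (2 + Real.log n) * ((1 + H'⁻¹) ^ N - 1) ≤ 1)
    (hyp : ∀ W, 0 < W → (∀ q, q.Prime → q ∣ W → q ∉ S) →
      ∑ m ∈ M with W ∣ j m, (m : ℝ)⁻¹ ≤ A * H ^ Ω W / W) :
    ∀ w, 0 < w → Ω w ≤ N → ∀ W, 0 < W → (∀ q, q.Prime → q ∣ W → q ∉ S) →
      ∑ m ∈ M with W ∣ j m ∧ w ∣ ∏ r ∈ simplePrimes S (j m) with ¬ r ∣ W, (r + 1), (m : ℝ)⁻¹ ≤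
        A * H ^ Ω W * H' ^ Ω w / (W * w) := by
  classical
  intro w
  induction w using Nat.strong_induction_on with
  | _ w ih =>
  intro hw hwN W hW hWS
  rcases Nat.eq_or_lt_of_le hw with h1 | h1
  · rw [← h1]
    simp only [Nat.succ_eq_add_one, zero_add, isUnit_one, IsUnit.dvd, and_true,
      ArithmeticFunction.cardFactors_one, pow_zero, mul_one, Nat.cast_one]
    exact hyp W hW hWS
  have hW0 : (0 : ℝ) < W := by exact_mod_cast hW
  have hw0 : (0 : ℝ) < w := by exact_mod_cast hw
  have hn1 : (1 : ℝ) ≤ n := by exact_mod_cast hn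
  have hlog : 0 ≤ Real.log n := Real.log_nonneg hn1
  set U : ℕ → ℕ → Finset ℕ := fun W w => M.filter fun m =>
    W ∣ j m ∧ w ∣ ∏ r ∈ simplePrimes S (j m) with ¬ r ∣ W, (r + 1) with hU
  set Rg : ℕ → Finset ℕ := fun g => (Finset.Icc 1 n).filter fun r => g ∣ r + 1 with hRg
  -- Some simple prime `r` has `r + 1` divisible by the least prime of `w`. It is moved into `W`,
  -- and `w` loses `g = gcd (w, r + 1) ≠ 1`. Excluding `r ∣ W` from the product keeps `r` coprime to
  -- `W`, so that `W * r` still divides `j m`.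
  have hcover : ∀ m ∈ U W w, ∃ x ∈ (w.divisors.erase 1).sigma Rg,
      m ∈ (if x.2.Prime ∧ x.2 ∉ S then U (W * x.2) (w / x.1) else ∅) := by
    intro m hm
    obtain ⟨hmM, hWj, hwd⟩ := Finset.mem_filter.mp hm
    set R := (simplePrimes S (j m)).filter fun r => ¬ r ∣ W with hR
    have hq := Nat.minFac_prime h1.ne'
    obtain ⟨r, hrR, hqr⟩ := (hq.prime.dvd_finsetProd_iff _).mp
      ((Nat.minFac_dvd w).trans hwd)
    obtain ⟨hr1, hrW⟩ := Finset.mem_filter.mp hrR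
    obtain ⟨hr2, hrS, hrsq⟩ := Finset.mem_filter.mp hr1
    have hrp := Nat.prime_of_mem_primeFactors hr2
    have hrj := Nat.dvd_of_mem_primeFactors hr2
    set g := w.gcd (r + 1) with hg
    have hgw : g ∣ w := Nat.gcd_dvd_left _ _
    have hg1 : g ≠ 1 := by
      intro h
      have : w.minFac ∣ g := Nat.dvd_gcd (Nat.minFac_dvd w) hqr
      rw [h] at this
      exact hq.one_lt.ne' (Nat.dvd_one.mp this)
    refine ⟨⟨g, r⟩, Finset.mem_sigma.mpr ⟨?_, ?_⟩, ?_⟩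
    · exact Finset.mem_erase.mpr ⟨hg1, Nat.mem_divisors.mpr ⟨hgw, hw.ne'⟩⟩
    · refine Finset.mem_filter.mpr ⟨Finset.mem_Icc.mpr ⟨hrp.pos, ?_⟩, Nat.gcd_dvd_right _ _⟩
      exact (Nat.le_of_dvd (hj m hmM).1 hrj).trans (hj m hmM).2
    · rw [if_pos ⟨hrp, hrS⟩]
      refine Finset.mem_filter.mpr ⟨hmM, ?_, ?_⟩
      · exact Nat.Coprime.mul_dvd_of_dvd_of_dvd ((hrp.coprime_iff_not_dvd.mpr hrW).symm) hWj hrj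
      · refine (dvd_prod_erase_of_dvd_prod hrR hw hwd).trans ?_
        refine Finset.prod_dvd_prod_of_subset _ _ _ ?_
        intro x hx
        obtain ⟨hxr, hxR⟩ := Finset.mem_erase.mp hx
        obtain ⟨hx1, hxW⟩ := Finset.mem_filter.mp hxR
        refine Finset.mem_filter.mpr ⟨hx1, fun hdvd => ?_⟩
        have hxp := Nat.prime_of_mem_primeFactors (Finset.mem_filter.mp hx1).1
        rcases hxp.dvd_mul.mp hdvd with h | h
        · exact hxW h
        · exact hxr ((Nat.prime_dvd_prime_iff_eq hxp hrp).mp h)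
  have hinner : ∀ x ∈ (w.divisors.erase 1).sigma Rg,
      ∑ m ∈ (if x.2.Prime ∧ x.2 ∉ S then U (W * x.2) (w / x.1) else ∅), (m : ℝ)⁻¹ ≤
        A * H ^ Ω W * H * H' ^ Ω w / (W * w) * ((H'⁻¹ ^ Ω x.1 * x.1) * (x.2 : ℝ)⁻¹) := by
    rintro ⟨g, r⟩ hx
    obtain ⟨hg, hr⟩ := Finset.mem_sigma.mp hx
    obtain ⟨hg1, hg2⟩ := Finset.mem_erase.mp hg
    have hgw : g ∣ w := Nat.dvd_of_mem_divisors hg2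
    replace hg1 : g ≠ 1 := hg1
    have hg0 : 0 < g := Nat.pos_of_mem_divisors hg2
    simp only at hr ⊢
    split_ifs with hcond
    · obtain ⟨hrp, hrS⟩ := hcond
      obtain ⟨c, rfl⟩ := hgw
      have hc0 : 0 < c := Nat.pos_of_mul_pos_left hw
      rw [Nat.mul_div_cancel_left c hg0]
      have hΩ : Ω (g * c) = Ω g + Ω c := ArithmeticFunction.cardFactors_mul hg0.ne' hc0.ne'
      have hclt : c < g * c := by
        have : 2 ≤ g := by omega
        nlinarith
      have hih := ih c hclt hc0 (by omega) (W * r) (Nat.mul_pos hW hrp.pos) (by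
        intro q hq hqd
        rcases hq.dvd_mul.mp hqd with h | h
        · exact hWS q hq h
        · rwa [(Nat.prime_dvd_prime_iff_eq hq hrp).mp h])
      refine hih.trans (le_of_eq ?_)
      rw [ArithmeticFunction.cardFactors_mul hW.ne' hrp.ne_zero,
        ArithmeticFunction.cardFactors_apply_prime hrp, hΩ]
      have hg0' : (0 : ℝ) < g := by exact_mod_cast hg0
      have hc0' : (0 : ℝ) < c := by exact_mod_cast hc0
      have hr0' : (0 : ℝ) < r := by exact_mod_cast hrp.pos
      push_cast
      rw [inv_pow]
      field_simp
      ring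
    · rw [Finset.sum_empty]; positivity
  -- Removing `g` costs one factor `H` and a sum of `1 / r` over `r ≡ -1 (mod g)`, and gains `H' ^
  -- (-Ω g)`. Since `g ≠ 1`, the total gain factor is small and `hnum` closes the induction.
  have hfin : ∑ g ∈ w.divisors.erase 1, H'⁻¹ ^ Ω g ≤ (1 + H'⁻¹) ^ N - 1 := by
    have e1 := sum_divisors_pow_cardFactors_le (inv_pos.mpr hH').le w
    have e2 := Finset.add_sum_erase w.divisors (fun g => H'⁻¹ ^ Ω g)
      (Nat.one_mem_divisors.mpr hw.ne')
    simp only [ArithmeticFunction.cardFactors_one, pow_zero] at e2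
    have e3 : (1 + H'⁻¹) ^ Ω w ≤ (1 + H'⁻¹) ^ N :=
      pow_le_pow_right₀ (by linarith [inv_pos.mpr hH']) hwN
    linarith
  calc ∑ m ∈ U W w, (m : ℝ)⁻¹
      ≤ ∑ x ∈ (w.divisors.erase 1).sigma Rg,
          ∑ m ∈ (if x.2.Prime ∧ x.2 ∉ S then U (W * x.2) (w / x.1) else ∅), (m : ℝ)⁻¹ :=
        sum_le_sum_sum_of_cover (fun m => by positivity) hcover
    _ ≤ ∑ x ∈ (w.divisors.erase 1).sigma Rg,
          A * H ^ Ω W * H * H' ^ Ω w / (W * w) * ((H'⁻¹ ^ Ω x.1 * x.1) * (x.2 : ℝ)⁻¹) :=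
        Finset.sum_le_sum hinner
    _ = A * H ^ Ω W * H * H' ^ Ω w / (W * w) *
          ∑ g ∈ w.divisors.erase 1, (H'⁻¹ ^ Ω g * g) * ∑ r ∈ Rg g, (r : ℝ)⁻¹ := by
        rw [← Finset.mul_sum, Finset.sum_sigma]
        simp only [Finset.mul_sum]
    _ ≤ A * H ^ Ω W * H * H' ^ Ω w / (W * w) *
          ∑ g ∈ w.divisors.erase 1, H'⁻¹ ^ Ω g * (2 * (2 + Real.log n)) := by
        refine mul_le_mul_of_nonneg_left (Finset.sum_le_sum fun g hg => ?_) (by positivity)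
        have hg0 : 0 < g := Nat.pos_of_mem_divisors (Finset.mem_erase.mp hg).2
        have hg0' : (0 : ℝ) < g := by exact_mod_cast hg0
        calc _ ≤ (H'⁻¹ ^ Ω g * g) * (2 * (2 + Real.log n) / g) :=
              mul_le_mul_of_nonneg_left (sum_inv_add_one_multiples_le hn hg0) (by positivity)
          _ = _ := by field_simp
    _ = A * H ^ Ω W * H' ^ Ω w / (W * w) *
          (2 * H * (2 + Real.log n) * ∑ g ∈ w.divisors.erase 1, H'⁻¹ ^ Ω g) := by
        rw [← Finset.sum_mul]; ring
    _ ≤ A * H ^ Ω W * H' ^ Ω w / (W * w) * 1 := by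
        refine mul_le_mul_of_nonneg_left (le_trans ?_ hnum) (by positivity)
        exact mul_le_mul_of_nonneg_left hfin (by positivity)
    _ = _ := mul_one _

theorem pow_cardFactors_le_of_le_primes {w : ℕ} (hw : w ≠ 0) {T : ℕ}
    (h : ∀ q, q.Prime → q ∣ w → T ≤ q) : T ^ Ω w ≤ w := by
  induction w using induction_on_primes with
  | zero => exact absurd rfl hw
  | one => simp
  | prime_mul p a hp ih =>
    have ha : a ≠ 0 := right_ne_zero_of_mul hw
    rw [ArithmeticFunction.cardFactors_mul hp.ne_zero ha,
      ArithmeticFunction.cardFactors_apply_prime hp, pow_add, pow_one]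
    exact Nat.mul_le_mul (h p hp (dvd_mul_right _ _))
      (ih ha fun q hq hqd => h q hq (hqd.mul_left p))

/-- The positive integers `m ≤ n` whose `k`-th sum-of-divisors iterate is `n`. -/
def sigmaFiber (k n : ℕ) : Finset ℕ := (Finset.Icc 1 n).filter fun m => sigmaOne^[k] m = n

theorem iterate_of_mem_sigmaFiber {k n m i : ℕ} (hm : m ∈ sigmaFiber k n) (hi : i ≤ k) :
    0 < sigmaOne^[i] m ∧ sigmaOne^[i] m ≤ n := by
  obtain ⟨h1, h2⟩ := Finset.mem_filter.mp hm
  have := sigmaOne_iterate_mono (Finset.mem_Icc.mp h1).1 hi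
  rwa [h2] at this

theorem natLog_le_two_mul_log {n : ℕ} (hn : n ≠ 0) : (Nat.log 2 n : ℝ) ≤ 2 * Real.log n := by
  have h : ((2 : ℝ) ^ Nat.log 2 n) ≤ n := by exact_mod_cast Nat.pow_log_le_self 2 hn
  have h1 := Real.log_le_log (by positivity) h
  rw [Real.log_pow] at h1
  have hl := Real.log_two_gt_d9
  nlinarith [(Nat.cast_nonneg (Nat.log 2 n) : (0 : ℝ) ≤ Nat.log 2 n)]

/-- The ratio `H' / H = y ^ 3` suffices: the exponent is at most `2 * y`, so the bracket is at most
`4 / (H * y ^ 2)`, against a prefactor of order `H * y`. -/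
theorem one_add_inv_pow_bound {n : ℕ} {H : ℝ} (hn : 20 ≤ Real.log n) (hH : 1 ≤ H) :
    2 * H * (2 + Real.log n) * ((1 + (H * Real.log n ^ 3)⁻¹) ^ Nat.log 2 n - 1) ≤ 1 := by
  have hn0 : n ≠ 0 := by rintro rfl; norm_num at hn
  set y := Real.log n
  set x := (H * y ^ 3)⁻¹ with hx
  have hx0 : 0 < x := by positivity
  have hN := natLog_le_two_mul_log hn0
  have hNx : Nat.log 2 n * x ≤ 2 * y * x := mul_le_mul_of_nonneg_right hN hx0.le
  have hxy : 2 * y * x = 2 / (H * y ^ 2) := by rw [hx]; field_simp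
  have hsmall : 2 * y * x ≤ 1 := by
    rw [hxy, div_le_one (by positivity)]
    nlinarith
  have h1 : (1 + x) ^ Nat.log 2 n ≤ 1 + 2 * (2 * y * x) := by
    calc (1 + x) ^ Nat.log 2 n ≤ Real.exp x ^ Nat.log 2 n := by
          gcongr; linarith [Real.add_one_le_exp x]
      _ = Real.exp (Nat.log 2 n * x) := by rw [← Real.exp_nat_mul]
      _ ≤ Real.exp (2 * y * x) := Real.exp_le_exp.mpr hNx
      _ ≤ 1 + 2 * (2 * y * x) := by
          have hz : 0 ≤ 2 * y * x := by positivity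
          have := Real.abs_exp_sub_one_le (x := 2 * y * x) (by rw [abs_of_nonneg hz]; exact hsmall)
          rw [abs_of_nonneg hz] at this
          linarith [le_abs_self (Real.exp (2 * y * x) - 1)]
  have hy0 : 0 < y := by linarith
  calc 2 * H * (2 + y) * ((1 + x) ^ Nat.log 2 n - 1) ≤ 2 * H * (2 + y) * (2 * (2 * y * x)) := by
        gcongr; linarith
    _ = 8 * (2 + y) / y ^ 2 := by rw [hxy]; field_simp; ring
    _ ≤ 1 := by rw [div_le_one (by positivity)]; nlinarith

/-- Induction on `i`: with the type fixed, `w` divides a product of `r + 1` over simple primes of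
the previous iterate, and each iterate raises the cost per prime of `w` by `y ^ 3`. -/
theorem sum_inv_squareType_le {k n T : ℕ} (hn : 20 ≤ Real.log n) (i : ℕ) (hi : i ≤ k) :
    ∀ (L : List ℕ) (w : ℕ), 0 < w → (∀ q, q.Prime → q ∣ w → q ∉ badPrimes n T L) →
      ∑ m ∈ sigmaFiber k n with squareType n T m i = L ∧ w ∣ sigmaOne^[i] m, (m : ℝ)⁻¹ ≤
        (1 + Real.log n) * (Real.log n ^ (3 * i)) ^ Ω w / w := by
  classical
  have hn0 : 0 < n := by
    rcases Nat.eq_zero_or_pos n with rfl | h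
    · norm_num at hn
    · exact h
  induction i with
  | zero =>
    intro L w hw _
    rw [mul_zero, pow_zero, one_pow, mul_one]
    refine le_trans ?_ (sum_inv_multiples_le (N := n) hw)
    refine Finset.sum_le_sum_of_subset_of_nonneg ?_ fun _ _ _ => by positivity
    intro m hm
    obtain ⟨h1, -, h2⟩ := Finset.mem_filter.mp hm
    exact Finset.mem_filter.mpr ⟨(Finset.mem_filter.mp h1).1, h2⟩
  | succ i ih =>
    intro L w hw hfree
    have hnn : 0 ≤ (1 + Real.log n) * (Real.log n ^ (3 * (i + 1))) ^ Ω w / w := by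
      have : 0 ≤ Real.log n := by linarith
      positivity
    cases L with
    | nil =>
      rw [Finset.filter_false_of_mem (fun m _ h => by simp [squareType] at h), Finset.sum_empty]
      exact hnn
    | cons v L =>
    by_cases hwn : n < w
    · rw [Finset.filter_false_of_mem, Finset.sum_empty]
      · exact hnn
      · rintro m hm ⟨-, hdvd⟩
        obtain ⟨h1, h2⟩ := iterate_of_mem_sigmaFiber hm hi
        exact absurd (Nat.le_of_dvd h1 hdvd) (by omega)
    push Not at hwn
    have hΩ : Ω w ≤ Nat.log 2 n := by
      refine Nat.le_log_of_pow_le one_lt_two (le_trans ?_ hwn)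
      exact pow_cardFactors_le_of_le_primes hw.ne' fun q hq _ => hq.two_le
    set M := (sigmaFiber k n).filter fun m => squareType n T m i = L with hM
    have hy1 : 1 ≤ Real.log n ^ (3 * i) := one_le_pow₀ (by linarith)
    have key := sum_inv_dvd_prod_simplePrimes_le (M := M) (S := badPrimes n T L)
      (j := fun m => sigmaOne^[i] m) (N := Nat.log 2 n) (A := 1 + Real.log n)
      (H := Real.log n ^ (3 * i)) (H' := Real.log n ^ (3 * i) * Real.log n ^ 3) hn0 (by linarith)
      (by linarith) (by positivity)
      (fun m hm => iterate_of_mem_sigmaFiber (Finset.mem_filter.mp hm).1 (by omega))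
      (one_add_inv_pow_bound hn hy1)
      (fun W hW hWS => by
        rw [hM, Finset.filter_filter]
        exact ih (by omega) L W hW hWS)
      w hw hΩ 1 one_pos (fun q hq hq1 => absurd (Nat.dvd_one.mp hq1) hq.ne_one)
    rw [ArithmeticFunction.cardFactors_one, pow_zero, mul_one, Nat.cast_one, one_mul, ← pow_add]
      at key
    rw [show 3 * (i + 1) = 3 * i + 3 by ring]
    refine le_trans ?_ key
    refine Finset.sum_le_sum_of_subset_of_nonneg ?_ fun _ _ _ => by positivity
    intro m hm
    obtain ⟨hm1, hm2, hm3⟩ := Finset.mem_filter.mp hm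
    rw [squareType, List.cons.injEq] at hm2
    obtain ⟨hv, hL⟩ := hm2
    refine Finset.mem_filter.mpr ⟨Finset.mem_filter.mpr ⟨hm1, hL⟩, one_dvd _, ?_⟩
    have hfilter : (simplePrimes (badPrimes n T L) (sigmaOne^[i] m)).filter (fun r => ¬ r ∣ 1) =
        simplePrimes (badPrimes n T L) (sigmaOne^[i] m) := by
      refine Finset.filter_true_of_mem fun r hr hr1 => ?_
      have := Nat.prime_of_mem_primeFactors (Finset.mem_filter.mp hr).1
      exact this.ne_one (Nat.dvd_one.mp hr1)
    rw [hfilter]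
    rw [Function.iterate_succ_apply'] at hm3
    refine dvd_prod_simplePrimes (n := n) (T := T)
      (iterate_of_mem_sigmaFiber hm1 (by omega : i ≤ k)).1 ?_ hm3 ?_
    · rw [← Function.iterate_succ_apply' sigmaOne]
      exact (iterate_of_mem_sigmaFiber hm1 hi).2
    · rw [hL] at hv
      rwa [hv]

/-- The square of the square part `v` divides the iterate, so the reciprocal sums are summed over `v
> V`. All primes of `v` exceed `T`, which makes the cost per prime at most `v ^ (1/2)` altogether
and leaves `v ^ (-3/2)`. -/
theorem card_large_squarePart_le {k n T i : ℕ} (hn : 20 ≤ Real.log n) (hi : i ≤ k)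
    (hT : Real.log n ^ (12 * k) ≤ T) (L : List ℕ) {V : ℝ} (hV : 1 ≤ V) :
    (((sigmaFiber k n).filter fun m => squareType n T m i = L ∧
      V < squarePart (badPrimes n T L) (sigmaOne^[i] m)).card : ℝ) ≤
        n * ((1 + Real.log n) ^ 2 * V ^ (-(1 / 2) : ℝ)) := by
  classical
  set y := Real.log n with hy
  set S := badPrimes n T L with hS
  set E := (sigmaFiber k n).filter fun m => squareType n T m i = L ∧
    V < squarePart S (sigmaOne^[i] m) with hE
  set I := (Finset.Icc 1 n).filter fun v : ℕ => V < v ∧ ∀ q, q.Prime → q ∣ v → q ∉ S with hI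
  -- Every `m` is at most `n`, so it counts for at most `n / m`.
  have hcard : (E.card : ℝ) ≤ n * ∑ m ∈ E, (m : ℝ)⁻¹ := by
    rw [Finset.mul_sum, ← nsmul_one, ← Finset.sum_const]
    refine Finset.sum_le_sum fun m hm => ?_
    obtain ⟨h1, h2⟩ := Finset.mem_Icc.mp
      (Finset.mem_filter.mp (Finset.mem_filter.mp hm).1).1
    have h1' : (0 : ℝ) < m := by exact_mod_cast h1
    rw [← div_eq_mul_inv, one_le_div h1']
    exact_mod_cast h2
  refine hcard.trans (mul_le_mul_of_nonneg_left ?_ (Nat.cast_nonneg n))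
  have hcover : ∀ m ∈ E, ∃ v ∈ I, m ∈ (sigmaFiber k n).filter fun m =>
      squareType n T m i = L ∧ v ^ 2 ∣ sigmaOne^[i] m := by
    intro m hm
    obtain ⟨h1, h2, h3⟩ := Finset.mem_filter.mp hm
    obtain ⟨h4, h5⟩ := iterate_of_mem_sigmaFiber h1 hi
    refine ⟨squarePart S (sigmaOne^[i] m), Finset.mem_filter.mpr ⟨Finset.mem_Icc.mpr
      ⟨squarePart_pos _ _, (squarePart_le h4).trans h5⟩, h3, fun q hq hqd => ?_⟩,
      Finset.mem_filter.mpr ⟨h1, h2, squarePart_sq_dvd _ _⟩⟩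
    exact ((prime_dvd_squarePart_iff h4.ne' hq).mp hqd).1
  have hV0 : 0 < V := by linarith
  calc ∑ m ∈ E, (m : ℝ)⁻¹ ≤ ∑ v ∈ I, ∑ m ∈ (sigmaFiber k n).filter fun m =>
        squareType n T m i = L ∧ v ^ 2 ∣ sigmaOne^[i] m, (m : ℝ)⁻¹ :=
        sum_le_sum_sum_of_cover (fun m => by positivity) hcover
    _ ≤ ∑ v ∈ I, (1 + y) * V ^ (-(1 / 2) : ℝ) * (v : ℝ)⁻¹ := by
        refine Finset.sum_le_sum fun v hv => ?_
        obtain ⟨hv1, hv2, hv3⟩ := Finset.mem_filter.mp hv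
        have hv0 : 0 < v := (Finset.mem_Icc.mp hv1).1
        have hv0' : (0 : ℝ) < v := by exact_mod_cast hv0
        refine (sum_inv_squareType_le hn i hi L (v ^ 2) (by positivity)
          fun q hq hqd => hv3 q hq (hq.dvd_of_dvd_pow hqd)).trans ?_
        rw [ArithmeticFunction.cardFactors_pow]
        have hTv : ((T : ℝ)) ^ Ω v ≤ v := by
          exact_mod_cast pow_cardFactors_le_of_le_primes hv0.ne' fun q hq hqd => by
            by_contra hlt
            exact hv3 q hq hqd (mem_badPrimes_of_le hq (by omega) L)
        -- The exponent 12 in the threshold is `3 * 2 * 2`: three per iterate, doubled by `v ^ 2`,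
        -- doubled again by the square root.
        have hH : ((y ^ (3 * i)) ^ (2 * Ω v)) ^ 2 ≤ v := by
          calc ((y ^ (3 * i)) ^ (2 * Ω v)) ^ 2 = (y ^ (12 * i)) ^ Ω v := by
                rw [← pow_mul, ← pow_mul, ← pow_mul]; ring_nf
            _ ≤ (T : ℝ) ^ Ω v := by
                refine pow_le_pow_left₀ (by positivity) (le_trans ?_ hT) _
                exact pow_le_pow_right₀ (by linarith) (by omega)
            _ ≤ v := hTv
        have hH' : (y ^ (3 * i)) ^ (2 * Ω v) ≤ (v : ℝ) ^ (1 / 2 : ℝ) := by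
          rw [← Real.sqrt_eq_rpow]
          exact Real.le_sqrt_of_sq_le hH
        have hvV : (v : ℝ) ^ (-(1 / 2) : ℝ) ≤ V ^ (-(1 / 2) : ℝ) :=
          Real.rpow_le_rpow_of_nonpos hV0 hv2.le (by norm_num)
        calc (1 + y) * (y ^ (3 * i)) ^ (2 * Ω v) / ((v ^ 2 : ℕ) : ℝ)
            ≤ (1 + y) * (v : ℝ) ^ (1 / 2 : ℝ) / ((v ^ 2 : ℕ) : ℝ) := by
              gcongr
          _ = (1 + y) * (v : ℝ) ^ (-(1 / 2) : ℝ) * (v : ℝ)⁻¹ := by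
              have : (v : ℝ) ^ (1 / 2 : ℝ) = (v : ℝ) ^ (-(1 / 2) : ℝ) * v := by
                nth_rewrite 3 [← Real.rpow_one (v : ℝ)]
                rw [← Real.rpow_add hv0']; norm_num
              rw [this]
              push_cast
              field_simp
          _ ≤ _ := by gcongr
    _ = (1 + y) * V ^ (-(1 / 2) : ℝ) * ∑ v ∈ I, (v : ℝ)⁻¹ := by rw [Finset.mul_sum]
    _ ≤ (1 + y) * V ^ (-(1 / 2) : ℝ) * (1 + y) := by
        refine mul_le_mul_of_nonneg_left ?_ (mul_nonneg (by linarith) (by positivity))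
        refine le_trans ?_ (sum_inv_Icc_le n)
        exact Finset.sum_le_sum_of_subset_of_nonneg (Finset.filter_subset _ _)
          fun _ _ _ => by positivity
    _ = _ := by ring

/-! ### Counting the fibre by square types. -/

theorem card_badPrimes_cons_le {n T v : ℕ} {L : List ℕ} (hv : 0 < v) (hvn : v ≤ n) :
    ((badPrimes n T (v :: L)).card : ℝ) ≤ ((badPrimes n T L).card + 2 * Real.log n) *
      (1 + (2 * Real.log n + 1) * (2 * Real.log n)) := by
  have hn : n ≠ 0 := by omega
  set S := badPrimes n T L ∪ v.primeFactors with hS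
  have hlog : ∀ x : ℕ, 0 < x → x ≤ n → (x.primeFactors.card : ℝ) ≤ 2 * Real.log n := by
    intro x hx hxn
    refine (card_primeFactors_le_log hx.ne').trans ?_
    have := Real.log_le_log (by exact_mod_cast hx) (by exact_mod_cast hxn : (x : ℝ) ≤ n)
    linarith
  have hl0 : 0 ≤ Real.log n := Real.log_natCast_nonneg n
  have hScard : (S.card : ℝ) ≤ (badPrimes n T L).card + 2 * Real.log n := by
    have h1 : (S.card : ℝ) ≤ (badPrimes n T L).card + v.primeFactors.card := by
      exact_mod_cast Finset.card_union_le _ _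
    linarith [hlog v hv hvn]
  set G : ℕ → ℕ → Finset ℕ := fun r e =>
    if sigmaOne (r ^ e) ≤ n then (sigmaOne (r ^ e)).primeFactors else ∅ with hG
  have hGcard : ∀ r e, ((G r e).card : ℝ) ≤ 2 * Real.log n := by
    intro r e
    rw [hG]
    dsimp only
    split_ifs with h
    · rcases Nat.eq_zero_or_pos (sigmaOne (r ^ e)) with h0 | h0
      · rw [h0]; simpa using hl0
      · exact hlog _ h0 h
    · simpa using hl0
  have hinner : ∀ r, ((((Finset.range (Nat.log 2 n + 1)).biUnion fun e => G r e).card : ℕ) : ℝ) ≤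
      (2 * Real.log n + 1) * (2 * Real.log n) := by
    intro r
    calc _ ≤ ∑ e ∈ Finset.range (Nat.log 2 n + 1), ((G r e).card : ℝ) := by
          exact_mod_cast Finset.card_biUnion_le
      _ ≤ ∑ e ∈ Finset.range (Nat.log 2 n + 1), 2 * Real.log n :=
          Finset.sum_le_sum fun e _ => hGcard r e
      _ = ((Nat.log 2 n : ℝ) + 1) * (2 * Real.log n) := by simp
      _ ≤ _ := by
          have := natLog_le_two_mul_log hn
          gcongr
  have hbad : badPrimes n T (v :: L) =
      S ∪ S.biUnion fun r => (Finset.range (Nat.log 2 n + 1)).biUnion fun e => G r e := by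
    rw [badPrimes]
  rw [hbad]
  calc _ ≤ (S.card : ℝ) +
        ∑ r ∈ S, ((((Finset.range (Nat.log 2 n + 1)).biUnion fun e => G r e).card : ℕ) : ℝ) := by
        exact_mod_cast (Finset.card_union_le _ _).trans
          (Nat.add_le_add_left Finset.card_biUnion_le _)
    _ ≤ (S.card : ℝ) + ∑ r ∈ S, (2 * Real.log n + 1) * (2 * Real.log n) := by
        gcongr with r
        exact hinner r
    _ = S.card * (1 + (2 * Real.log n + 1) * (2 * Real.log n)) := by simp; ring
    _ ≤ _ := by gcongr

theorem card_badPrimes_squareType_le {k n T m : ℕ} (hk : 0 < k) (hn : 40 ≤ Real.log n)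
    (hT : (T : ℝ) ≤ Real.log n ^ (12 * k) + 1) (hm : m ∈ sigmaFiber k n) (i : ℕ) (hi : i ≤ k) :
    ((badPrimes n T (squareType n T m i)).card : ℝ) ≤ Real.log n ^ (12 * k + 1 + 5 * i) := by
  set y := Real.log n
  induction i with
  | zero =>
    rw [squareType, badPrimes]
    have h1 : (((Finset.range (T + 1)).filter Nat.Prime).card : ℝ) ≤ T + 1 := by
      exact_mod_cast (Finset.card_filter_le _ _).trans (by simp)
    have h2 : 1 ≤ y ^ (12 * k) := one_le_pow₀ (by linarith)
    rw [mul_zero, add_zero, pow_succ]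
    nlinarith
  | succ i ih =>
    obtain ⟨h1, h2⟩ := iterate_of_mem_sigmaFiber hm (by omega : i ≤ k)
    rw [squareType]
    refine (card_badPrimes_cons_le (squarePart_pos _ _) ((squarePart_le h1).trans h2)).trans ?_
    have hih := ih (by omega)
    set c := y ^ (12 * k + 1 + 5 * i) with hc
    have hyc : y ≤ c := le_self_pow₀ (by linarith) (by omega)
    calc _ ≤ (3 * c) * (7 * y ^ 2) := by
          refine mul_le_mul (by linarith) ?_ (by positivity) (by positivity)
          change 1 + (2 * y + 1) * (2 * y) ≤ 7 * y ^ 2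
          nlinarith
      _ = c * y ^ 2 * 21 := by ring
      _ ≤ c * y ^ 2 * y ^ 3 := by
          refine mul_le_mul_of_nonneg_left ?_ (by positivity)
          have : y ≤ y ^ 3 := le_self_pow₀ (by linarith) (by omega)
          linarith
      _ = _ := by rw [hc]; ring

/-- A prime outside the final exceptional set divides each of the first `k` iterates at most once:
otherwise it would divide a recorded square part and so be exceptional. Hence the `q + 1` link
applies to it. -/
theorem squareType_fiber_subset_chainSet {k n T m₀ : ℕ} (hn : 0 < n) :
    ((sigmaFiber k n).filter fun m => squareType n T m k = squareType n T m₀ k) ⊆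
      chainSet (badPrimes n T (squareType n T m₀ k)) n n k := by
  intro m hm
  obtain ⟨h1, h2⟩ := Finset.mem_filter.mp hm
  refine iterate_mem_chainSet hn (Finset.mem_filter.mp h1).2
    (fun i hi => iterate_of_mem_sigmaFiber h1 hi.le) fun i hi q hq hqd => ?_
  have hj := (iterate_of_mem_sigmaFiber h1 hi.le).1
  by_cases hQ : q ∈ badPrimes n T (squareType n T m₀ k)
  · exact Or.inl hQ
  right; right
  rw [Function.iterate_succ_apply']
  refine add_one_dvd_sigmaOne hj.ne' hq hqd fun hsq => hQ ?_
  rw [← h2]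
  by_cases hS : q ∈ badPrimes n T (squareType n T m i)
  · exact badPrimes_squareType_mono hi.le hS
  · refine badPrimes_squareType_mono (Nat.succ_le_of_lt hi) ?_
    rw [squareType]
    refine primeFactors_subset_badPrimes_cons n T _ _ ?_
    refine Nat.mem_primeFactors.mpr ⟨hq, ?_, (squarePart_pos _ _).ne'⟩
    exact (prime_dvd_squarePart_iff hj.ne' hq).mpr ⟨hS, hsq⟩

/-- Either the next square part is at most `V`, leaving at most `V` ways to extend the type, or it
is large and the rarity bound applies. -/
theorem card_squareType_fiber_le {k n T i : ℕ} (hn : 20 ≤ Real.log n) (hi : i < k)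
    (hT : Real.log n ^ (12 * k) ≤ T) (L : List ℕ) {V R : ℝ} (hV : 1 ≤ V)
    (hR : ∀ L', (((sigmaFiber k n).filter fun m => squareType n T m (i + 1) = L').card : ℝ) ≤ R) :
    (((sigmaFiber k n).filter fun m => squareType n T m i = L).card : ℝ) ≤
      V * R + n * ((1 + Real.log n) ^ 2 * V ^ (-(1 / 2) : ℝ)) := by
  classical
  have hR0 : 0 ≤ R := (Nat.cast_nonneg _).trans (hR [])
  set E := (sigmaFiber k n).filter fun m => squareType n T m i = L ∧
    V < squarePart (badPrimes n T L) (sigmaOne^[i] m)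
  set I := Finset.Icc 1 ⌊V⌋₊
  have hsub : ((sigmaFiber k n).filter fun m => squareType n T m i = L) ⊆
      (I.biUnion fun v => (sigmaFiber k n).filter fun m => squareType n T m (i + 1) = v :: L) ∪
        E := by
    intro m hm
    obtain ⟨h1, h2⟩ := Finset.mem_filter.mp hm
    rw [Finset.mem_union]
    by_cases hlt : V < squarePart (badPrimes n T L) (sigmaOne^[i] m)
    · exact Or.inr (Finset.mem_filter.mpr ⟨h1, h2, hlt⟩)
    · left
      refine Finset.mem_biUnion.mpr ⟨squarePart (badPrimes n T L) (sigmaOne^[i] m),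
        Finset.mem_Icc.mpr ⟨squarePart_pos _ _, Nat.le_floor (not_lt.mp hlt)⟩,
        Finset.mem_filter.mpr ⟨h1, ?_⟩⟩
      rw [squareType, h2]
  have hE := card_large_squarePart_le hn hi.le hT L hV
  calc _ ≤ ∑ v ∈ I, (((sigmaFiber k n).filter fun m =>
          squareType n T m (i + 1) = v :: L).card : ℝ) + E.card := by
        exact_mod_cast (Finset.card_le_card hsub).trans ((Finset.card_union_le _ _).trans
          (Nat.add_le_add_right Finset.card_biUnion_le _))
    _ ≤ ∑ v ∈ I, R + E.card := by
        gcongr with v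
        exact hR _
    _ ≤ V * R + E.card := by
        rw [Finset.sum_const, nsmul_eq_mul]
        have : (I.card : ℝ) ≤ V := by
          rw [Nat.card_Icc, Nat.add_sub_cancel]
          exact Nat.floor_le (by linarith)
        gcongr
    _ ≤ _ := by linarith

/-- The threshold below which primes are not tracked. -/
noncomputable def primeThreshold (k n : ℕ) : ℕ := ⌈Real.log n ^ (12 * k)⌉₊

/-- The recorded type is shortened one entry at a time, from the full type (`l = 0`), where the
chain bound applies, to the empty type (`l = k`), which is the whole fibre. -/
theorem eventually_card_squareType_fiber_le {k : ℕ} (hk : 0 < k) {δ : ℕ → ℝ}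
    (hδ : ∀ᶠ n in atTop, δ n ≤ 1 / 4)
    (hδ' : ∀ᶠ n : ℕ in atTop, Real.log n ^ (3 / 4 : ℝ) ≤ δ n * Real.log n)
    (hsum : ∀ B : ℝ, ∀ᶠ n : ℕ in atTop, ∀ (Q : Finset ℕ) (X : ℕ), (Q.card : ℝ) ≤ Real.log n ^ B →
        ∑ d ∈ chainSet Q X n k, (d : ℝ) ^ (-(1 - δ n)) ≤ Real.exp (√(Real.log n)))
    (l : ℕ) (hl : l ≤ k) :
    ∃ c : ℝ, 0 < c ∧ ∀ᶠ n : ℕ in atTop, ∀ L, (((sigmaFiber k n).filter fun m =>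
      squareType n (primeThreshold k n) m (k - l) = L).card : ℝ) ≤
        n * Real.exp (-(c * (δ n * Real.log n))) := by
  induction l with
  | zero =>
    refine ⟨1 / 2, by norm_num, ?_⟩
    filter_upwards [hδ, hδ', hsum ((12 * k + 1 + 5 * k : ℕ) : ℝ), eventually_ge_atTop 1,
      tendsto_log_natCast.eventually (eventually_ge_atTop 40),
      tendsto_log_natCast.eventually (eventually_log_add_sqrt_le 0)] with n h1 h2 h3 h4 h5 h6 L
    rw [Nat.sub_zero]
    set T := primeThreshold k n with hT
    set y := Real.log n with hy
    have hn0 : (0 : ℝ) < n := by exact_mod_cast h4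
    set M := (sigmaFiber k n).filter fun m => squareType n T m k = L with hM
    rcases M.eq_empty_or_nonempty with he | ⟨m₀, hm₀⟩
    · rw [he, Finset.card_empty, Nat.cast_zero]
      positivity
    obtain ⟨hm1, rfl⟩ := Finset.mem_filter.mp hm₀
    have hTle : (T : ℝ) ≤ y ^ (12 * k) + 1 := (Nat.ceil_lt_add_one (by positivity)).le
    have hQ := card_badPrimes_squareType_le hk h5 hTle hm1 k le_rfl
    have hs := h3 (badPrimes n T (squareType n T m₀ k)) n (by rwa [Real.rpow_natCast])
    have hδ0 : 0 ≤ δ n := by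
      have : 0 ≤ δ n * y := le_trans (by positivity) h2
      exact nonneg_of_mul_nonneg_left this (by linarith)
    refine (card_le_rpow_mul_sum (Y := n) (c := 1 - δ n) (squareType_fiber_subset_chainSet h4)
      (by linarith) hn0.le fun m hm => ?_).trans ?_
    · have := Finset.mem_Icc.mp (Finset.mem_filter.mp (Finset.mem_filter.mp hm).1).1
      exact ⟨this.1, by exact_mod_cast this.2⟩
    calc _ ≤ (n : ℝ) ^ (1 - δ n) * Real.exp √y := mul_le_mul_of_nonneg_left hs (by positivity)
      _ ≤ Real.exp y * Real.exp (-(1 / 2 * (δ n * y))) := by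
          rw [Real.rpow_def_of_pos hn0, ← Real.exp_add, ← Real.exp_add, Real.exp_le_exp]
          change y * (1 - δ n) + √y ≤ _
          linarith
      _ = _ := by rw [hy, Real.exp_log hn0]
  | succ l ih =>
    obtain ⟨c, hc, hcn⟩ := ih (by omega)
    -- With `D = δ n * y` and `V = exp (c / 2 * D)`, the two cases save `exp (-c / 2 * D)` and `exp
    -- (-c / 4 * D)`; a factor `exp (c / 8 * D)` absorbs the power of `y`.
    refine ⟨c / 8, by positivity, ?_⟩
    filter_upwards [hcn, hδ', eventually_ge_atTop 1,
      tendsto_log_natCast.eventually (eventually_ge_atTop 20),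
      tendsto_log_natCast.eventually (eventually_mul_log_add_le_rpow
        (by norm_num : (0 : ℝ) < 3 / 4) (32 / c) 0)] with n h1 h2 h3 h4 h5 L
    have hn0 : (0 : ℝ) < n := by exact_mod_cast h3
    set y := Real.log n with hy
    set D := δ n * y with hD
    have hD0 : 0 ≤ D := le_trans (by positivity) h2
    set T := primeThreshold k n with hT
    have hTle : y ^ (12 * k) ≤ T := Nat.le_ceil _
    rw [show k - l = k - (l + 1) + 1 by omega] at h1
    refine (card_squareType_fiber_le (V := Real.exp (c / 2 * D)) h4 (by omega) hTle L
      (Real.one_le_exp (by positivity)) h1).trans ?_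
    have e1 : Real.exp (c / 2 * D) * (n * Real.exp (-(c * D))) ≤ n * Real.exp (-(c / 4 * D)) := by
      rw [mul_left_comm, ← Real.exp_add]
      refine mul_le_mul_of_nonneg_left (Real.exp_le_exp.mpr ?_) hn0.le
      nlinarith
    have e2 : Real.exp (c / 2 * D) ^ (-(1 / 2) : ℝ) = Real.exp (-(c / 4 * D)) := by
      rw [← Real.exp_mul]; ring_nf
    have e3 : 1 + (1 + y) ^ 2 ≤ Real.exp (c / 8 * D) := by
      have h6 : 1 + (1 + y) ^ 2 ≤ y ^ 4 := by
        have h9 : 20 * 20 * y ^ 2 ≤ y ^ 2 * y ^ 2 := by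
          refine mul_le_mul_of_nonneg_right ?_ (sq_nonneg y)
          nlinarith
        nlinarith
      have h7 : y ^ 4 = Real.exp (4 * Real.log y) := by
        rw [show (4 : ℝ) = ((4 : ℕ) : ℝ) by norm_num, ← Real.log_pow,
          Real.exp_log (by positivity)]
      rw [h7] at h6
      refine h6.trans (Real.exp_le_exp.mpr ?_)
      have h8 : 32 / c * Real.log y ≤ D := by linarith
      rw [div_mul_eq_mul_div, div_le_iff₀ hc] at h8
      linarith
    rw [e2]
    calc _ ≤ n * ((1 + (1 + y) ^ 2) * Real.exp (-(c / 4 * D))) := by linarith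
      _ ≤ n * (Real.exp (c / 8 * D) * Real.exp (-(c / 4 * D))) := by gcongr
      _ = _ := by rw [← Real.exp_add]; ring_nf

theorem sigma_count_le {k : ℕ} (hk : 0 < k) {δ : ℕ → ℝ} (hδ : ∀ᶠ n in atTop, δ n ≤ 1 / 4)
    (hδ' : ∀ᶠ n : ℕ in atTop, Real.log n ^ (3 / 4 : ℝ) ≤ δ n * Real.log n)
    (hsum : ∀ B : ℝ, ∀ᶠ n : ℕ in atTop, ∀ (Q : Finset ℕ) (X : ℕ), (Q.card : ℝ) ≤ Real.log n ^ B →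
        ∑ d ∈ chainSet Q X n k, (d : ℝ) ^ (-(1 - δ n)) ≤ Real.exp (√(Real.log n))) :
    ∃ c : ℝ, 0 < c ∧ ∀ᶠ n : ℕ in atTop, (iteratePreimage sigmaOne k n).Finite ∧
      (iteratePreimageCount sigmaOne k n : ℝ) ≤ n * Real.exp (-(c * (δ n * Real.log n))) := by
  obtain ⟨c, hc, h⟩ := eventually_card_squareType_fiber_le hk hδ hδ' hsum k le_rfl
  refine ⟨c, hc, ?_⟩
  filter_upwards [h] with n hn
  have hset : iteratePreimage sigmaOne k n = sigmaFiber k n := by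
    ext m
    simp only [iteratePreimage, Set.mem_ofPred_eq, sigmaFiber, Finset.coe_filter, Finset.mem_Icc]
    refine ⟨fun h => ⟨⟨h.1, ?_⟩, h.2⟩, fun h => ⟨h.1.1, h.2⟩⟩
    rw [← h.2]
    exact (sigmaOne_iterate_mono h.1 (Nat.zero_le k)).2
  refine ⟨hset ▸ (sigmaFiber k n).finite_toSet, ?_⟩
  rw [iteratePreimageCount, hset, Set.ncard_coe_finset]
  have := hn []
  simpa [squareType] using this

/-! ### Conclusion. -/

theorem theorem1 (a : ℕ → ℕ)
    (ha : a = Nat.totient ∨ a = fun m => ArithmeticFunction.sigma 1 m)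
    (k : ℕ) (hk : 0 < k) (β : ℝ) (hβ : β < (k : ℝ) - 1) :
    ∃ ε : ℕ → ℝ, Filter.Tendsto ε Filter.atTop (nhds 0) ∧
      ∀ᶠ n : ℕ in Filter.atTop,
        (iteratePreimage a k n).Finite ∧
        (iteratePreimageCount a k n : ℝ) ≤ (n : ℝ) / pomeranceL k (β + 1) n ^ (1 + ε n) := by
  obtain ⟨δ, hδ, hδ', hratio, hsum⟩ := exists_saving hk (γ := β + 1) (by linarith)
  have hcount : ∃ c : ℝ, 0 < c ∧ ∀ᶠ n : ℕ in atTop, (iteratePreimage a k n).Finite ∧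
      (iteratePreimageCount a k n : ℝ) ≤ n * Real.exp (-(c * (δ n * Real.log n))) := by
    rcases ha with rfl | rfl
    · exact totient_count_le hδ hδ' hsum
    · exact sigma_count_le hk hδ hδ' hsum
  obtain ⟨c, hc, hcn⟩ := hcount
  -- Since `δ` beats `1 / c` times the required rate, the constant `c` is absorbed and no error term
  -- remains.
  refine ⟨fun _ => 0, tendsto_const_nhds, ?_⟩
  filter_upwards [hcn, hratio (1 / c)] with n h1 h2
  refine ⟨h1.1, h1.2.trans ?_⟩
  rw [add_zero, Real.rpow_one, pomeranceL, div_eq_mul_inv, ← Real.exp_neg]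
  refine mul_le_mul_of_nonneg_left (Real.exp_le_exp.mpr ?_) (Nat.cast_nonneg n)
  rw [neg_le_neg_iff]
  rw [one_div, inv_mul_le_iff₀ hc] at h2
  have := mul_le_mul_of_nonneg_left h2 (Real.log_natCast_nonneg n)
  rw [mul_div_assoc]
  linarith
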